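/- Let $p$ be a prime and let $I$ be a finite set. Let $\mathcal A$ be a diagram of finite groups over $I$: finite groups $B$, $G_i$ ($i\in I$) and $G_{ij}=G_{ji}$ ($i\neq j$ in $I$), with injective homomorphisms $B\to G_i$ and $G_i\to G_{ij}$ such that the two composites $B\to G_i\to G_{ij}$ and $B\to G_j\to G_{ij}$ agree. Let $G$ be a faithful completion of $\mathcal A$, that is, a group with injective homomorphisms from $B$, all $G_i$ and all $G_{ij}$ to $G$ which commute with the maps of the diagram; regard $B$, $G_i$, $G_{ij}$ as subgroups of $G$. Let $\mathcal C$ be the chamber system over $I$ whose chambers are the left cosets of $B$ in $G$, where $gB$ and $hB$ are $i$-adjacent if $gG_i=hG_i$; $G$ acts on it by left multiplication. A chamber system is connected if it is non-empty and any two chambers are joined by a gallery (a finite sequence of chambers in which consecutive ones are $i$-adjacent for some $i\in I$). Sets of fixed chambers carry the induced adjacency, and in a quotient by a group two orbits are $i$-adjacent if they contain $i$-adjacent chambers. Assume that the fixed subsystem $\mathcal C^P$ is connected for every finite $p$-subgroup $P$ of $G$. For subgroups $S\le H$ of $G$, with $S$ a finite $p$-group, let $\mathcal F_S(H)$ be the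 category whose objects are the subgroups of $S$ and whose morphisms $P\to Q$ are the homomorphisms $x\mapsto gxg^{-1}$ with $g\in H$ and $gPg^{-1}\le Q$. Let $S$ be a Sylow $p$-subgroup of $B$ and put $\mathcal F=\mathcal F_S(G)$. For a fusion system $\mathcal E$ over $S$, a subgroup $P\le S$ is fully $\mathcal E$-normalized (fully $\mathcal E$-centralized) if $|N_S(P)|\ge|N_S(\varphi(P))|$ (respectively $|C_S(P)|\ge|C_S(\varphi(P))|$) for all $\varphi\in\mathrm{Hom}_{\mathcal E}(P,S)$; it is $\mathcal E$-centric if $C_S(\varphi(P))=Z(\varphi(P))$ for all such $\varphi$; it is $\mathcal E$-essential if it is $\mathcal E$-centric and $\mathrm{Out}_{\mathcal E}(P)=\mathrm{Aut}_{\mathcal E}(P)/\mathrm{Inn}(P)$ has a strongly $p$-embedded subgroup, i.e. a proper subgroup $M$ containing a Sylow $p$-subgroup $Q\neq1$ of $\mathrm{Out}_{\mathcal E}(P)$ with $hQh^{-1}\cap Q=1$ for all $h\in\mathrm{Out}_{\mathcal E}(P)\setminus M$. For $P\le S$ put $\mathrm{Aut}_G(P)=N_G(P)/C_G(P)$, which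 acts on $\mathcal C^P/C_G(P)$. Suppose: (a) if $P\le S$ is $\mathcal F$-centric and fully $\mathcal F$-normalized, then $\mathrm{Aut}_G(P)$ acts transitively on the chambers of $\mathcal C^P/C_G(P)$; (b) if $P\le S$ is $\mathcal F$-centric and $R$ is a $p$-subgroup of $\mathrm{Aut}_G(P)$, then the fixed subsystem $(\mathcal C^P/C_G(P))^R$ is connected; (c) if $i\in I$ and $P\le S$ is $\mathcal F_S(G_i)$-essential, then $P$ is $\mathcal F$-centric. Then $S$ is a Sylow $p$-subgroup of $G$, i.e. $S$ is a finite $p$-subgroup of $G$ and every finite $p$-subgroup of $G$ is conjugate in $G$ to a subgroup of $S$; and $\mathcal F$ is a saturated fusion system over $S$, i.e. (I) every fully $\mathcal F$-normalized $P\le S$ is fully $\mathcal F$-centralized and $\mathrm{Aut}_S(P)$ is a Sylow $p$-subgroup of $\mathrm{Aut}_{\mathcal F}(P)$; and (II) if $P\le S$ and $\varphi\in\mathrm{Hom}_{\mathcal F}(P,S)$ are such that $\varphi(P)$ is fully $\mathcal F$-centralized, then $\varphi$ extends to a morphism in $\mathrm{Hom}_{\mathcal F}(N_\varphi,S)$,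 where $N_\varphi=\{x\in N_S(P): \varphi\circ c_x\circ\varphi^{-1}\in\mathrm{Aut}_S(\varphi(P))\}$ and $c_x$ is conjugation by $x$. -/

import Mathlib

/-! ### Chamber systems -/

/-- A family of equivalence relations `adj i`, indexed by `I`, on the set `C` of chambers.
Nonemptiness is part of `ChamberSystem.Connected`, so that fixed-point subsystems are always
defined. -/
structure ChamberSystem (I : Type*) (C : Type*) where
  adj : I → Setoid C

namespace ChamberSystem

variable {I C : Type*}

/-- There are chambers, and any two are joined by a gallery. -/
def Connected (X : ChamberSystem I C) : Prop :=
  Nonempty C ∧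
    ∀ c d : C, Relation.ReflTransGen (fun x y => ∃ i : I, (X.adj i).r x y) c d

/-- The chamber subsystem on a set of chambers. -/
def restrict (X : ChamberSystem I C) (D : Set C) : ChamberSystem I D where
  adj i := (X.adj i).comap Subtype.val

/-- The chamber subsystem of the chambers that are fixed by `H`. -/
def fixed (X : ChamberSystem I C) (H : Type*) [Monoid H] [MulAction H C] :
    ChamberSystem I (MulAction.fixedPoints H C) :=
  X.restrict (MulAction.fixedPoints H C)

/-- `H` acts by automorphisms of the chamber system. -/
def Preserved (X : ChamberSystem I C) (H : Type*) [SMul H C] : Prop :=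
  ∀ (h : H) (i : I) (c d : C), (X.adj i).r c d → (X.adj i).r (h • c) (h • d)

/-- The chamber system of orbits: two orbits are `i`-adjacent if they have `i`-adjacent
representatives. -/
def orbits (X : ChamberSystem I C) (H : Type*) [Group H] [MulAction H C] (hX : X.Preserved H) :
    ChamberSystem I (MulAction.orbitRel.Quotient H C) where
  adj i :=
    { r := fun x y => ∃ c d : C, Quotient.mk _ c = x ∧ Quotient.mk _ d = y ∧ (X.adj i).r c d
      iseqv :=
        { refl := fun x => by
            obtain ⟨c, rfl⟩ := Quotient.exists_rep x
            exact ⟨c, c, rfl, rfl, (X.adj i).refl c⟩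
          symm := by
            rintro _ _ ⟨c, d, rfl, rfl, h⟩
            exact ⟨d, c, rfl, rfl, (X.adj i).symm h⟩
          trans := by
            rintro _ _ _ ⟨c, d, rfl, rfl, h⟩ ⟨d', e, h', rfl, h''⟩
            obtain ⟨g, hg⟩ := MulAction.orbitRel_apply.1 (Quotient.exact h'.symm)
            have hg : g • d' = d := hg
            refine ⟨c, g • e, rfl, ?_, (X.adj i).trans h ?_⟩
            · exact Quotient.sound (MulAction.orbitRel_apply.2 ⟨g, rfl⟩)
            · rw [← hg]
              exact hX g i d' e h'' } }

/-- The chambers are the cosets `gB`, and `gB`, `hB` are `i`-adjacent if `g(K i) = h(K i)`. -/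
def coset {G : Type*} [Group G] (B : Subgroup G) (K : I → Subgroup G) (h : ∀ i, B ≤ K i) :
    ChamberSystem I (G ⧸ B) where
  adj i := Setoid.ker (Subgroup.quotientMapOfLE (h i))

theorem coset_preserved {G : Type*} [Group G] (B : Subgroup G) (K : I → Subgroup G)
    (h : ∀ i, B ≤ K i) : (coset B K h).Preserved G := by
  rintro g i c d hcd
  obtain ⟨a, rfl⟩ := QuotientGroup.mk_surjective c
  obtain ⟨b, rfl⟩ := QuotientGroup.mk_surjective d
  have hcd : (a : G ⧸ K i) = (b : G ⧸ K i) := hcd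
  change ((g * a : G) : G ⧸ K i) = ((g * b : G) : G ⧸ K i)
  rw [QuotientGroup.eq] at hcd ⊢
  simpa [mul_assoc] using hcd

end ChamberSystem

/-! ### The action of `Aut_G(P) = N_G(P) / C_G(P)` on the `C_G(P)`-orbits of `P`-fixed points -/

section Actions

variable {G : Type*} [Group G]

/-- `N_G(P)` acts on the fixed points of `P`. -/
instance normalizerFixedPointsAction (X : Type*) [MulAction G X] (P : Subgroup G) :
    MulAction (Subgroup.normalizer (P : Set G)) (MulAction.fixedPoints P X) where
  smul n x := ⟨(n : G) • (x : X), fun q => by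
    have hq : (n : G)⁻¹ * q * n ∈ P := (Subgroup.mem_normalizer_iff''.1 n.2 q).1 q.2
    have := x.2 ⟨_, hq⟩
    rw [Subgroup.smul_def] at this ⊢
    conv_rhs => rw [← this]
    simp [smul_smul, mul_assoc]⟩
  one_smul x := Subtype.ext (one_smul G (x : X))
  mul_smul a b x := Subtype.ext (mul_smul (a : G) (b : G) (x : X))

/-- `C_G(P)`, as a subgroup of `N_G(P)`. -/
abbrev centInNorm (P : Subgroup G) : Subgroup (Subgroup.normalizer (P : Set G)) :=
  (Subgroup.centralizer (P : Set G)).subgroupOf (Subgroup.normalizer (P : Set G))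

instance centInNorm_normal (P : Subgroup G) : (centInNorm P).Normal := by
  rw [centInNorm, ← Subgroup.normalizerMonoidHom_ker]
  infer_instance

/-- `Aut_G(P) = N_G(P) / C_G(P)`. -/
abbrev AutBy (P : Subgroup G) : Type _ := Subgroup.normalizer (P : Set G) ⧸ centInNorm P

/-- If `N` acts on `X` and `K` is normal in `N`, then `N / K` acts on the set of `K`-orbits by
`(nK) • (Kx) = K(nx)`. -/
instance quotientOrbitsAction {N X : Type*} [Group N] [MulAction N X] (K : Subgroup N)
    [K.Normal] : MulAction (N ⧸ K) (MulAction.orbitRel.Quotient K X) where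
  smul := Quotient.map₂ (fun n x => n • x) (by
    intro a b hab x y hxy
    have hab : a⁻¹ * b ∈ K := QuotientGroup.leftRel_apply.1 hab
    obtain ⟨k, hk⟩ := MulAction.orbitRel_apply.1 hxy
    have hk : (k : N) • y = x := hk
    refine MulAction.orbitRel_apply.2 ⟨⟨a * k * b⁻¹, ?_⟩, ?_⟩
    · have h1 : a * (k * (a⁻¹ * b)⁻¹) * a⁻¹ ∈ K :=
        ‹K.Normal›.conj_mem _ (K.mul_mem k.2 (K.inv_mem hab)) a
      simpa [mul_assoc] using h1
    · change (a * k * b⁻¹) • b • y = a • x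
      rw [← hk]
      simp [smul_smul, mul_assoc])
  one_smul := by
    rintro ⟨x⟩
    exact congrArg (Quotient.mk _) (one_smul N x)
  mul_smul := by
    rintro ⟨a⟩ ⟨b⟩ ⟨x⟩
    exact congrArg (Quotient.mk _) (mul_smul a b x)

/-- The set of `C_G(P)`-orbits of `P`-fixed points. -/
abbrev FixedOrbits (P : Subgroup G) (X : Type*) [MulAction G X] : Type _ :=
  MulAction.orbitRel.Quotient (centInNorm P) (MulAction.fixedPoints P X)

/-- If `G` acts on the chamber system by automorphisms: the chamber system `C^P / C_G(P)`. -/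
def ChamberSystem.fixedOrbits {I C : Type*} [MulAction G C] (X : ChamberSystem I C)
    (hX : X.Preserved G) (P : Subgroup G) : ChamberSystem I (FixedOrbits P C) :=
  (X.fixed P).orbits (centInNorm P)
    (fun h i c d hcd => hX ((h : Subgroup.normalizer (P : Set G)) : G) i c d hcd)

end Actions

/-! ### Diagrams of finite groups and their completions -/

/-- A diagram of finite groups over `I`, with groups `B`, `G i` and `GG {i, j}` (`i ≠ j`). -/
structure GroupDiagram (I : Type*) where
  B : Type*
  G : I → Type*
  GG : {e : Sym2 I // ¬ e.IsDiag} → Type*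
  [groupB : Group B]
  [groupG : ∀ i, Group (G i)]
  [groupGG : ∀ e, Group (GG e)]
  [finiteB : Finite B]
  [finiteG : ∀ i, Finite (G i)]
  [finiteGG : ∀ e, Finite (GG e)]
  /-- `B → G i` -/
  τ : ∀ i, B →* G i
  /-- `G i → GG {i, j}` -/
  ττ : ∀ (e : {e : Sym2 I // ¬ e.IsDiag}) (i : I), i ∈ e.1 → (G i →* GG e)
  τ_injective : ∀ i, Function.Injective (τ i)
  ττ_injective : ∀ e i hi, Function.Injective (ττ e i hi)
  comm : ∀ e i j (hi : i ∈ e.1) (hj : j ∈ e.1), (ττ e i hi).comp (τ i) = (ττ e j hj).comp (τ j)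

namespace GroupDiagram

attribute [instance] groupB groupG groupGG finiteB finiteG finiteGG

variable {I : Type*}

/-- A completion of a diagram of groups. -/
structure Completion (A : GroupDiagram I) (Γ : Type*) [Group Γ] where
  φ : A.B →* Γ
  φi : ∀ i, A.G i →* Γ
  φe : ∀ e, A.GG e →* Γ
  comm_B : ∀ i, (φi i).comp (A.τ i) = φ
  comm_G : ∀ e i hi, (φe e).comp (A.ττ e i hi) = φi i

namespace Completion

variable {A : GroupDiagram I} {Γ : Type*} [Group Γ]

/-- All the homomorphisms to the completion are injective. -/
def Faithful (Φ : A.Completion Γ) : Prop :=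
  Function.Injective Φ.φ ∧ (∀ i, Function.Injective (Φ.φi i)) ∧
    ∀ e, Function.Injective (Φ.φe e)

/-- `B` as a subgroup of the completion. -/
def subB (Φ : A.Completion Γ) : Subgroup Γ := Φ.φ.range

/-- `G i` as a subgroup of the completion. -/
def subG (Φ : A.Completion Γ) (i : I) : Subgroup Γ := (Φ.φi i).range

theorem subB_le_subG (Φ : A.Completion Γ) (i : I) : Φ.subB ≤ Φ.subG i := by
  rintro _ ⟨b, rfl⟩
  exact ⟨A.τ i b, by rw [← MonoidHom.comp_apply, Φ.comm_B]⟩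

/-- The chamber system of the left cosets of `B` in the completion. -/
def chambers (Φ : A.Completion Γ) : ChamberSystem I (Γ ⧸ Φ.subB) :=
  ChamberSystem.coset Φ.subB Φ.subG Φ.subB_le_subG

/-- The chamber system `C^P / C_G(P)`. -/
def chambersFixedOrbits (Φ : A.Completion Γ) (P : Subgroup Γ) :
    ChamberSystem I (FixedOrbits P (Γ ⧸ Φ.subB)) :=
  Φ.chambers.fixedOrbits (ChamberSystem.coset_preserved _ _ _) P

end Completion

end GroupDiagram

/-! ### Fusion systems -/

/-- The image of a homomorphism between subgroups of `S`, as a subgroup of `S`. -/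
def imageIn {S : Type*} [Group S] {P Q : Subgroup S} (φ : P →* Q) : Subgroup S :=
  (Q.subtype.comp φ).range

/-- A fusion system on the group `S`: a category whose objects are the subgroups of `S`, whose
morphisms are injective homomorphisms and include those induced by conjugation in `S`, and in
which every morphism is an isomorphism of the category followed by an inclusion. (The identities
belong to it by `conj_mem`.) -/
structure FusionSystem (S : Type*) [Group S] where
  Hom : ∀ P Q : Subgroup S, Set (P →* Q)
  comp_mem : ∀ {P Q R : Subgroup S} {φ : P →* Q} {ψ : Q →* R},
    φ ∈ Hom P Q → ψ ∈ Hom Q R → ψ.comp φ ∈ Hom P R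
  conj_mem : ∀ {P Q : Subgroup S} (φ : P →* Q) (s : S),
    (∀ x : P, (φ x : S) = s * x * s⁻¹) → φ ∈ Hom P Q
  injective : ∀ {P Q : Subgroup S} {φ : P →* Q}, φ ∈ Hom P Q → Function.Injective φ
  factor : ∀ {P Q : Subgroup S} {φ : P →* Q}, φ ∈ Hom P Q →
    ∃ (R : Subgroup S) (hR : R ≤ Q) (e : P ≃* R),
      e.toMonoidHom ∈ Hom P R ∧ e.symm.toMonoidHom ∈ Hom R P ∧
        φ = (Subgroup.inclusion hR).comp e.toMonoidHom

/-- `M` is a strongly `p`-embedded subgroup of `H`. -/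
def IsStronglyEmbedded (p : ℕ) {H : Type*} [Group H] (M : Subgroup H) : Prop :=
  M ≠ ⊤ ∧ ∃ Q : Sylow p H, (Q : Subgroup H) ≤ M ∧ (Q : Subgroup H) ≠ ⊥ ∧
    ∀ h ∉ M, (Q : Subgroup H).map (MulAut.conj h).toMonoidHom ⊓ (Q : Subgroup H) = ⊥

/-- `Aut_S(P)`, as a group of automorphisms of `P`. -/
def autSelf {S : Type*} [Group S] (P : Subgroup S) : Subgroup (MulAut P) :=
  P.normalizerMonoidHom.range

/-- `Inn(P)`. -/
def innAut (P : Type*) [Group P] : Subgroup (MulAut P) := (MulAut.conj : P →* MulAut P).range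

instance innAut_normal (P : Type*) [Group P] : (innAut P).Normal where
  conj_mem := by
    rintro _ ⟨x, rfl⟩ g
    exact ⟨g x, by ext y; simp [MulAut.mul_apply]⟩

/-- `N_φ`: the `x ∈ N_S(P)` such that `φ ∘ c_x ∘ φ⁻¹` is conjugation by some
`y ∈ N_S(φ(P))`. -/
def extender {S : Type*} [Group S] {P Q : Subgroup S} (φ : P →* Q) : Subgroup S where
  carrier := {x | ∃ hx : x ∈ Subgroup.normalizer (P : Set S),
    ∃ y ∈ Subgroup.normalizer (imageIn φ : Set S),
      ∀ u : P, (φ (P.normalizerMonoidHom ⟨x, hx⟩ u) : S) = y * φ u * y⁻¹}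
  one_mem' := ⟨Subgroup.one_mem _, 1, Subgroup.one_mem _, fun u => by
    have : P.normalizerMonoidHom ⟨1, Subgroup.one_mem _⟩ = 1 := map_one P.normalizerMonoidHom
    simp [this]⟩
  mul_mem' := by
    rintro a b ⟨ha, y, hy, h⟩ ⟨hb, z, hz, k⟩
    refine ⟨mul_mem ha hb, y * z, mul_mem hy hz, fun u => ?_⟩
    have e : P.normalizerMonoidHom ⟨a * b, mul_mem ha hb⟩
        = P.normalizerMonoidHom ⟨a, ha⟩ * P.normalizerMonoidHom ⟨b, hb⟩ :=
      map_mul P.normalizerMonoidHom ⟨a, ha⟩ ⟨b, hb⟩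
    rw [e, MulAut.mul_apply, h, k]
    group
  inv_mem' := by
    rintro a ⟨ha, y, hy, h⟩
    refine ⟨inv_mem ha, y⁻¹, inv_mem hy, fun u => ?_⟩
    have e : P.normalizerMonoidHom ⟨a⁻¹, inv_mem ha⟩ = (P.normalizerMonoidHom ⟨a, ha⟩)⁻¹ :=
      map_inv P.normalizerMonoidHom ⟨a, ha⟩
    have := h ((P.normalizerMonoidHom ⟨a, ha⟩)⁻¹ u)
    rw [MulAut.apply_inv_self] at this
    rw [e, this]
    group

theorem le_extender {S : Type*} [Group S] {P Q : Subgroup S} (φ : P →* Q) :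
    P ≤ extender φ := by
  intro x hx
  refine ⟨Subgroup.le_normalizer hx, φ ⟨x, hx⟩, Subgroup.le_normalizer ⟨⟨x, hx⟩, rfl⟩, fun u => ?_⟩
  have : P.normalizerMonoidHom ⟨x, Subgroup.le_normalizer hx⟩ u = ⟨x, hx⟩ * u * ⟨x, hx⟩⁻¹ :=
    Subtype.ext rfl
  rw [this]
  simp

namespace FusionSystem

variable {S : Type*} [Group S] (F : FusionSystem S)

/-- `|C_S(P)| ≥ |C_S(φ(P))|` for all `φ ∈ Hom_F(P, S)`. -/
def FullyCentralized (P : Subgroup S) : Prop :=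
  ∀ φ ∈ F.Hom P ⊤, Nat.card (Subgroup.centralizer (imageIn φ : Set S)) ≤
    Nat.card (Subgroup.centralizer (P : Set S))

/-- `|N_S(P)| ≥ |N_S(φ(P))|` for all `φ ∈ Hom_F(P, S)`. -/
def FullyNormalized (P : Subgroup S) : Prop :=
  ∀ φ ∈ F.Hom P ⊤, Nat.card (Subgroup.normalizer (imageIn φ : Set S)) ≤
    Nat.card (Subgroup.normalizer (P : Set S))

/-- `C_S(φ(P)) = Z(φ(P))` for all `φ ∈ Hom_F(P, S)`. -/
def Centric (P : Subgroup S) : Prop :=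
  ∀ φ ∈ F.Hom P ⊤, Subgroup.centralizer (imageIn φ : Set S) =
    (Subgroup.center (imageIn φ)).map (imageIn φ).subtype

/-- `Aut_F(P)`, as a group of automorphisms of `P`. -/
def Aut (P : Subgroup S) : Subgroup (MulAut P) where
  carrier := {e | e.toMonoidHom ∈ F.Hom P P}
  one_mem' := F.conj_mem _ 1 (fun x => by simp)
  mul_mem' := fun {_ _} ha hb => F.comp_mem hb ha
  inv_mem' := by
    intro a ha
    obtain ⟨R, hR, e, -, he, h⟩ := F.factor ha
    have hx : ∀ x : P, ((a x : P) : S) = e x := fun x => by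
      have := congrArg (fun f : P →* P => ((f x : P) : S)) h
      simpa using this
    have hRP : R = P := by
      refine le_antisymm hR fun x hxP => ?_
      have := hx (a⁻¹ ⟨x, hxP⟩)
      rw [MulAut.apply_inv_self] at this
      change x = _ at this
      rw [this]
      exact (e _).2
    subst hRP
    have : a = e := MulEquiv.ext fun x => Subtype.ext (hx x)
    rw [this]
    exact he

/-- `Out_F(P) = Aut_F(P) / Inn(P)`. -/
abbrev Out (P : Subgroup S) : Type _ := F.Aut P ⧸ (innAut P).subgroupOf (F.Aut P)

/-- `P` is `F`-essential. -/
def Essential (p : ℕ) (P : Subgroup S) : Prop :=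
  F.Centric P ∧ ∃ M : Subgroup (F.Out P), IsStronglyEmbedded p M

/-- `F` is a saturated fusion system over the finite `p`-group `S`. -/
structure Saturated (p : ℕ) : Prop where
  finite : Finite S
  isPGroup : IsPGroup p S
  fullyCentralized : ∀ P, F.FullyNormalized P → F.FullyCentralized P
  sylow : ∀ P, F.FullyNormalized P →
    ∃ T : Sylow p (F.Aut P), (T : Subgroup (F.Aut P)) = (autSelf P).subgroupOf (F.Aut P)
  extends_to : ∀ (P : Subgroup S), ∀ φ ∈ F.Hom P ⊤, F.FullyCentralized (imageIn φ) →
    ∃ ψ ∈ F.Hom (extender φ) ⊤, ψ.comp (Subgroup.inclusion (le_extender φ)) = φ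

end FusionSystem

/-- The fusion system `F_S(H)`, for subgroups `S ≤ H` of a group `Γ`: the morphisms `P → Q` are
the homomorphisms that are induced by conjugation by elements of `H`. -/
def fusionOf {Γ : Type*} [Group Γ] (S H : Subgroup Γ) (hSH : S ≤ H) : FusionSystem S where
  Hom P Q := {φ | ∃ g ∈ H, ∀ x : P, ((φ x : S) : Γ) = g * ((x : S) : Γ) * g⁻¹}
  comp_mem := by
    rintro P Q R φ ψ ⟨g, hg, h⟩ ⟨k, hk, h'⟩
    refine ⟨k * g, mul_mem hk hg, fun x => ?_⟩
    rw [MonoidHom.comp_apply, h', h]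
    group
  conj_mem := fun φ s h => ⟨s, hSH s.2, fun x => by rw [h x]; rfl⟩
  injective := by
    rintro P Q φ ⟨g, -, h⟩ x y hxy
    have := h x
    rw [hxy, h y] at this
    simpa using this.symm
  factor := by
    rintro P Q φ ⟨g, hg, h⟩
    have hinj : Function.Injective (Q.subtype.comp φ) := by
      intro x y hxy
      have hxy : ((φ x : S) : Γ) = ((φ y : S) : Γ) := congrArg Subtype.val hxy
      rw [h x, h y] at hxy
      simpa using hxy
    have hR : (Q.subtype.comp φ).range ≤ Q := by
      rintro _ ⟨x, rfl⟩
      exact (φ x).2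
    refine ⟨(Q.subtype.comp φ).range, hR, MonoidHom.ofInjective hinj, ⟨g, hg, h⟩,
      ⟨g⁻¹, inv_mem hg, fun y => ?_⟩, rfl⟩
    obtain ⟨x, rfl⟩ := (MonoidHom.ofInjective hinj).surjective y
    have hx : (((MonoidHom.ofInjective hinj x : (Q.subtype.comp φ).range) : S) : Γ)
        = g * ((x : S) : Γ) * g⁻¹ := h x
    rw [hx]
    simp [mul_assoc]

/-- `S` is a Sylow `p`-subgroup of the possibly infinite group `Γ`: it is a finite `p`-subgroup,
and every finite `p`-subgroup of `Γ` is conjugate to a subgroup of `S`. -/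
def IsSylowIn (p : ℕ) {Γ : Type*} [Group Γ] (S : Subgroup Γ) : Prop :=
  Finite S ∧ IsPGroup p S ∧ ∀ Q : Subgroup Γ, Finite Q → IsPGroup p Q →
    ∃ g : Γ, Q.map (MulAut.conj g).toMonoidHom ≤ S

open scoped Pointwise
open MulAut (conj)

section FiniteSubgroups

variable {G : Type*} [Group G] {p : ℕ}

theorem mem_conj_smul_iff {g x : G} {A : Subgroup G} : x ∈ conj g • A ↔ g⁻¹ * x * g ∈ A := by
  rw [Subgroup.mem_pointwise_smul_iff_inv_smul_mem, ← map_inv, MulAut.smul_def, MulAut.conj_apply,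
    inv_inv]

theorem conj_smul_le_iff {g : G} {A B : Subgroup G} :
    conj g • A ≤ B ↔ ∀ a ∈ A, g * a * g⁻¹ ∈ B := by
  constructor
  · intro h a ha
    exact h (mem_conj_smul_iff.2 (by simpa [mul_assoc] using ha))
  · intro h x hx
    have := h _ (mem_conj_smul_iff.1 hx)
    simpa [mul_assoc] using this

theorem le_conj_smul_iff {g : G} {A B : Subgroup G} :
    A ≤ conj g • B ↔ ∀ a ∈ A, g⁻¹ * a * g ∈ B :=
  ⟨fun h _ ha => mem_conj_smul_iff.1 (h ha), fun h a ha => mem_conj_smul_iff.2 (h a ha)⟩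

theorem le_conj_smul_iff_conj_inv_smul_le {g : G} {A B : Subgroup G} :
    A ≤ conj g • B ↔ conj g⁻¹ • A ≤ B := by
  rw [map_inv, Subgroup.subset_pointwise_smul_iff]

theorem conj_smul_le_iff_le_conj_inv_smul {g : G} {A B : Subgroup G} :
    conj g • A ≤ B ↔ A ≤ conj g⁻¹ • B := by
  rw [map_inv, Subgroup.pointwise_smul_subset_iff]

theorem conj_mul_smul (g h : G) (A : Subgroup G) : conj (g * h) • A = conj g • conj h • A := by
  rw [map_mul, mul_smul]

theorem conj_one_smul (A : Subgroup G) : conj (1 : G) • A = A := by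
  rw [map_one, one_smul]

theorem conj_inv_smul_smul (g : G) (A : Subgroup G) : conj g⁻¹ • conj g • A = A := by
  rw [← conj_mul_smul, inv_mul_cancel, conj_one_smul]

theorem conj_smul_inv_smul (g : G) (A : Subgroup G) : conj g • conj g⁻¹ • A = A := by
  rw [← conj_mul_smul, mul_inv_cancel, conj_one_smul]

theorem conj_smul_mono (g : G) {A B : Subgroup G} (h : A ≤ B) : conj g • A ≤ conj g • B :=
  Subgroup.pointwise_smul_le_pointwise_smul_iff.2 h

theorem conj_mul_smul_le {g h : G} {A B D : Subgroup G} (hA : conj h • A ≤ B)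
    (hB : conj g • B ≤ D) : conj (g * h) • A ≤ D := by
  rw [conj_mul_smul]
  exact (conj_smul_mono g hA).trans hB

theorem card_conj_smul (g : G) (A : Subgroup G) :
    Nat.card (conj g • A : Subgroup G) = Nat.card A :=
  Nat.card_congr (Subgroup.equivSMul (conj g) A).symm.toEquiv

theorem mem_normalizer_iff_conj_smul_eq {g : G} {A : Subgroup G} :
    g ∈ Subgroup.normalizer (A : Set G) ↔ conj g • A = A := by
  rw [Subgroup.mem_normalizer_iff, eq_comm, SetLike.ext_iff]
  constructor
  · intro h x
    rw [mem_conj_smul_iff, h (g⁻¹ * x * g)]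
    simp [mul_assoc]
  · intro h x
    rw [h (g * x * g⁻¹), mem_conj_smul_iff]
    simp [mul_assoc]

theorem conj_smul_le_of_le_of_mem {e : G} {A E : Subgroup G} (hA : A ≤ E) (he : e ∈ E) :
    conj e • A ≤ E :=
  conj_smul_le_iff.2 fun _ ha => E.mul_mem (E.mul_mem he (hA ha)) (E.inv_mem he)

theorem mem_normalizer_of_conj_smul_le {g : G} {A : Subgroup G} [Finite A]
    (h : conj g • A ≤ A) : g ∈ Subgroup.normalizer (A : Set G) :=
  mem_normalizer_iff_conj_smul_eq.2
    (Subgroup.eq_of_le_of_card_ge h (card_conj_smul g A).ge)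

theorem centralizer_conj_smul (g : G) (A : Subgroup G) :
    Subgroup.centralizer ((conj g • A : Subgroup G) : Set G) =
      conj g • Subgroup.centralizer (A : Set G) := by
  ext x
  rw [mem_conj_smul_iff, Subgroup.mem_centralizer_iff, Subgroup.mem_centralizer_iff]
  constructor
  · intro h a ha
    have := h (g * a * g⁻¹) (mem_conj_smul_iff.2 (by simpa [mul_assoc] using ha))
    have h2 := congrArg (fun y => g⁻¹ * y * g) this
    simpa [mul_assoc] using h2
  · intro h a ha
    have := h _ (mem_conj_smul_iff.1 ha)
    have h2 := congrArg (fun y => g * y * g⁻¹) this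
    simpa [mul_assoc] using h2

theorem normalizer_conj_smul (g : G) (A : Subgroup G) :
    Subgroup.normalizer ((conj g • A : Subgroup G) : Set G) =
      conj g • Subgroup.normalizer (A : Set G) := by
  ext x
  rw [mem_conj_smul_iff, mem_normalizer_iff_conj_smul_eq, mem_normalizer_iff_conj_smul_eq,
    conj_mul_smul, conj_mul_smul]
  constructor
  · intro h
    rw [h, conj_inv_smul_smul]
  · intro h
    have := congrArg (fun B => conj g • B) h
    simpa only [conj_smul_inv_smul] using this

theorem normalizer_le_normalizer_centralizer (A : Subgroup G) :
    Subgroup.normalizer (A : Set G) ≤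
      Subgroup.normalizer (Subgroup.centralizer (A : Set G) : Set G) := by
  intro g hg
  rw [mem_normalizer_iff_conj_smul_eq] at hg ⊢
  rw [← centralizer_conj_smul, hg]

theorem mem_sup_iff_of_le_normalizer {A B : Subgroup G}
    (h : A ≤ Subgroup.normalizer (B : Set G)) {x : G} :
    x ∈ A ⊔ B ↔ ∃ a ∈ A, ∃ b ∈ B, a * b = x := by
  rw [← SetLike.mem_coe, Subgroup.coe_mul_of_left_le_normalizer_right A B h, Set.mem_mul]
  rfl

theorem mem_sup_iff_of_le_normalizer' {A B : Subgroup G}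
    (h : A ≤ Subgroup.normalizer (B : Set G)) {x : G} :
    x ∈ A ⊔ B ↔ ∃ b ∈ B, ∃ a ∈ A, b * a = x := by
  rw [sup_comm, ← SetLike.mem_coe, Subgroup.coe_mul_of_right_le_normalizer_left B A h, Set.mem_mul]
  rfl

theorem finite_of_le {A B : Subgroup G} [Finite B] (h : A ≤ B) : Finite A :=
  Finite.of_injective _ (Subgroup.inclusion_injective h)

/-- `V` is a finite `p`-subgroup. -/
def IsFinPSubgroup (p : ℕ) (V : Subgroup G) : Prop := Finite V ∧ IsPGroup p V

namespace IsFinPSubgroup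

theorem mono {A B : Subgroup G} (hB : IsFinPSubgroup p B) (h : A ≤ B) : IsFinPSubgroup p A := by
  have := hB.1
  exact ⟨finite_of_le h, hB.2.to_le h⟩

theorem conj_smul {A : Subgroup G} (hA : IsFinPSubgroup p A) (g : G) :
    IsFinPSubgroup p (conj g • A) := by
  have := hA.1
  exact ⟨Finite.of_equiv _ (Subgroup.equivSMul (conj g) A).toEquiv,
    hA.2.of_equiv (Subgroup.equivSMul (conj g) A)⟩

theorem sup {A B : Subgroup G} (hA : IsFinPSubgroup p A) (hB : IsFinPSubgroup p B)
    (h : A ≤ Subgroup.normalizer (B : Set G)) : IsFinPSubgroup p (A ⊔ B) := by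
  refine ⟨?_, hA.2.to_sup_of_normal_right' hB.2 h⟩
  have := hA.1
  have := hB.1
  have hf : (((A ⊔ B : Subgroup G) : Set G)).Finite := by
    rw [Subgroup.coe_mul_of_left_le_normalizer_right A B h]
    exact Set.Finite.mul (Set.toFinite _) (Set.toFinite _)
  exact hf.to_subtype

theorem lt_inf_normalizer [Fact p.Prime] {R T : Subgroup G} (hT : IsFinPSubgroup p T)
    (h : R < T) : R < T ⊓ Subgroup.normalizer (R : Set G) := by
  refine lt_of_le_of_ne (le_inf h.le Subgroup.le_normalizer) fun heq => ?_
  have := hT.1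
  have : Group.IsNilpotent T := hT.2.isNilpotent
  have hlt : R.subgroupOf T < ⊤ := by
    rw [lt_top_iff_ne_top, ne_eq, Subgroup.subgroupOf_eq_top]
    exact h.not_ge
  obtain ⟨x, hx, hxR⟩ := SetLike.exists_of_lt (Group.normalizerCondition_of_isNilpotent _ hlt)
  apply hxR
  rw [Subgroup.mem_subgroupOf]
  rw [heq]
  refine ⟨x.2, Subgroup.mem_normalizer_iff.2 fun y => ?_⟩
  rw [Subgroup.mem_normalizer_iff] at hx
  constructor
  · intro hy
    exact (hx ⟨y, h.le hy⟩).1 hy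
  · intro hy
    have hyT : y ∈ T := by
      have := T.mul_mem (T.mul_mem (T.inv_mem x.2) (h.le hy)) x.2
      simpa [mul_assoc] using this
    exact (hx ⟨y, hyT⟩).2 hy

end IsFinPSubgroup

/-- `W` is a finite `p`-subgroup of `E`, and every finite `p`-subgroup of `E` is conjugate in `E`
to a subgroup of `W`. -/
def IsSylowOf (p : ℕ) (W E : Subgroup G) : Prop :=
  W ≤ E ∧ IsFinPSubgroup p W ∧
    ∀ V ≤ E, IsFinPSubgroup p V → ∃ e ∈ E, conj e • V ≤ W

theorem IsSylowOf.card_le {W E V : Subgroup G} (hW : IsSylowOf p W E) (hV : V ≤ E)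
    (hVp : IsFinPSubgroup p V) : Nat.card V ≤ Nat.card W := by
  obtain ⟨e, -, h⟩ := hW.2.2 V hV hVp
  have := hW.2.1.1
  rw [← card_conj_smul e V]
  exact Subgroup.card_le_of_le h

theorem isSylowOf_of_sylow [Fact p.Prime] {E : Subgroup G} [Finite E] (T : Sylow p E) :
    IsSylowOf p ((T : Subgroup E).map E.subtype) E := by
  refine ⟨Subgroup.map_subtype_le _, ⟨finite_of_le (Subgroup.map_subtype_le _), T.2.map _⟩, fun V hV hVp => ?_⟩
  obtain ⟨Q, hQ⟩ := (hVp.2.comap_subtype (K := E)).exists_le_sylow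
  obtain ⟨e, he⟩ := MulAction.exists_smul_eq E Q T
  refine ⟨e, e.2, conj_smul_le_iff.2 fun v hv => ?_⟩
  have hvQ : (⟨v, hV hv⟩ : E) ∈ Q := hQ hv
  refine ⟨e * ⟨v, hV hv⟩ * e⁻¹, ?_, rfl⟩
  change _ ∈ T
  rw [← he]
  exact Subgroup.smul_mem_pointwise_smul _ (conj e) _ hvQ

theorem exists_isSylowOf_ge [Fact p.Prime] {E U : Subgroup G} [Finite E] (hU : U ≤ E)
    (hUp : IsPGroup p U) : ∃ W, IsSylowOf p W E ∧ U ≤ W := by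
  obtain ⟨Q, hQ⟩ := (hUp.comap_subtype (K := E)).exists_le_sylow
  exact ⟨_, isSylowOf_of_sylow Q, fun u hu => ⟨⟨u, hU hu⟩, hQ hu, rfl⟩⟩

theorem isSylowOf_of_card_le [Fact p.Prime] {E W : Subgroup G} [Finite E] (hW : W ≤ E)
    (hWp : IsPGroup p W) (h : ∀ V ≤ E, IsFinPSubgroup p V → Nat.card V ≤ Nat.card W) :
    IsSylowOf p W E := by
  obtain ⟨W', hW', hle⟩ := exists_isSylowOf_ge hW hWp
  have := hW'.2.1.1
  rwa [Subgroup.eq_of_le_of_card_ge hle (h W' hW'.1 hW'.2.1)]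

theorem IsSylowOf.of_le [Fact p.Prime] {E E' W : Subgroup G} (hW : IsSylowOf p W E)
    (hE : E' ≤ E) (hWE : W ≤ E') [Finite E'] : IsSylowOf p W E' :=
  isSylowOf_of_card_le hWE hW.2.1.2 fun _ hV hVp => hW.card_le (hV.trans hE) hVp

theorem IsSylowOf.inf [Fact p.Prime] {E W D : Subgroup G} [Finite E] (hW : IsSylowOf p W E)
    (hD : E ≤ Subgroup.normalizer (D : Set G)) : IsSylowOf p (W ⊓ D) (E ⊓ D) := by
  have : Finite (E ⊓ D : Subgroup G) := finite_of_le inf_le_left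
  refine isSylowOf_of_card_le (inf_le_inf_right D hW.1) (hW.2.1.mono inf_le_left).2
    fun V hV hVp => ?_
  obtain ⟨e, he, h⟩ := hW.2.2 V (hV.trans inf_le_left) hVp
  have := (hW.2.1.mono (inf_le_left (b := D))).1
  rw [← card_conj_smul e V]
  refine Subgroup.card_le_of_le (le_inf h ?_)
  rw [← mem_normalizer_iff_conj_smul_eq.1 (hD he)]
  exact conj_smul_mono e (hV.trans inf_le_right)

theorem sup_eq_top_of_index [hp : Fact p.Prime] {A K : Subgroup G} [K.Normal]
    (hA : ¬ p ∣ A.index) (hK : IsPGroup p (G ⧸ K)) : A ⊔ K = ⊤ := by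
  have hA0 : A.index ≠ 0 := fun h => hA (h ▸ dvd_zero p)
  have h0 : (A ⊔ K).index ≠ 0 := fun h => hA0 (by
    have := Subgroup.index_dvd_of_le (le_sup_left : A ≤ A ⊔ K)
    rw [h] at this
    exact Nat.eq_zero_of_zero_dvd this)
  have hidx : ((A ⊔ K).map (QuotientGroup.mk' K)).index = (A ⊔ K).index := by
    rw [Subgroup.index_map_eq _ (QuotientGroup.mk'_surjective K)]
    rw [QuotientGroup.ker_mk']
    exact le_sup_right
  have : ((A ⊔ K).map (QuotientGroup.mk' K)).FiniteIndex := ⟨by rw [hidx]; exact h0⟩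
  obtain ⟨n, hn⟩ := hK.index ((A ⊔ K).map (QuotientGroup.mk' K))
  rw [hidx] at hn
  rw [← Subgroup.index_eq_one, hn]
  rcases Nat.eq_zero_or_pos n with rfl | hpos
  · simp
  · exact absurd ((dvd_pow_self p hpos.ne').trans
      (hn ▸ Subgroup.index_dvd_of_le (le_sup_left : A ≤ A ⊔ K))) hA

theorem IsSylowOf.exists_sylow {E W : Subgroup G} [Finite E] (hW : IsSylowOf p W E) :
    ∃ T : Sylow p E, (T : Subgroup E) = W.subgroupOf E := by
  have hmax : ∀ Q : Subgroup E, IsPGroup p Q → W.subgroupOf E ≤ Q → Q = W.subgroupOf E := by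
    intro Q hQ hle
    refine (Subgroup.eq_of_le_of_card_ge hle ?_).symm
    have h1 := hW.card_le (Subgroup.map_subtype_le Q)
      ⟨finite_of_le (Subgroup.map_subtype_le Q), hQ.map _⟩
    rw [Nat.card_congr (Subgroup.subgroupOfEquivOfLe hW.1).toEquiv]
    rwa [Nat.card_congr (Subgroup.equivMapOfInjective Q E.subtype E.subtype_injective).toEquiv]
  exact ⟨⟨W.subgroupOf E, hW.2.1.2.comap_subtype, fun {Q} hQ hle => hmax Q hQ hle⟩, rfl⟩

/-- If `E` is a finite group with Sylow subgroup `W`, and `E / (E ∩ D)` is a `p`-group, then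
`E = W (E ∩ D)`. -/
theorem IsSylowOf.le_sup [Fact p.Prime] {E W D : Subgroup G} [Finite E] (hW : IsSylowOf p W E)
    (hD : E ≤ Subgroup.normalizer (D : Set G)) (h : ∀ x ∈ E, ∃ k : ℕ, x ^ p ^ k ∈ D) :
    E ≤ W ⊔ D := by
  obtain ⟨T, hT⟩ := hW.exists_sylow
  have hn : (D.subgroupOf E).Normal := Subgroup.normal_subgroupOf_of_le_normalizer hD
  have hq : IsPGroup p (E ⧸ D.subgroupOf E) := by
    rw [isPGroup_iff_pow_pow_eq_one]
    intro x
    obtain ⟨x, rfl⟩ := QuotientGroup.mk_surjective x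
    obtain ⟨k, hk⟩ := h x x.2
    refine ⟨k, ?_⟩
    rw [← QuotientGroup.mk_pow, QuotientGroup.eq_one_iff, Subgroup.mem_subgroupOf]
    exact hk
  have := sup_eq_top_of_index (A := (T : Subgroup E)) T.not_dvd_index hq
  intro x hx
  have hxt : (⟨x, hx⟩ : E) ∈ W.subgroupOf E ⊔ D.subgroupOf E := by
    rw [← hT, this]
    trivial
  have := Subgroup.mem_map_of_mem E.subtype hxt
  rw [Subgroup.map_sup] at this
  have hle : (W.subgroupOf E).map E.subtype ⊔ (D.subgroupOf E).map E.subtype ≤ W ⊔ D := by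
    refine sup_le_sup ?_ ?_ <;>
    · rintro _ ⟨y, hy, rfl⟩
      exact hy
  exact hle this

end FiniteSubgroups

section CentralizerSylow

variable {G : Type*} [Group G] {p : ℕ}

/-- Whenever `C_G(P) ≤ L ≤ N_G(P)` and `L / C_G(P)` is a `p`-group, there is a finite `p`-subgroup
`V` with `L = V C_G(P)`, and every finite `p`-subgroup of `L` is `C_G(P)`-conjugate to a subgroup
of `V`. -/
def HasCentralizerSylow (p : ℕ) (P : Subgroup G) : Prop :=
  ∀ L : Subgroup G, Subgroup.centralizer (P : Set G) ≤ L → L ≤ Subgroup.normalizer (P : Set G) →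
    (∀ x ∈ L, ∃ k : ℕ, x ^ p ^ k ∈ Subgroup.centralizer (P : Set G)) →
      ∃ V ≤ L, IsFinPSubgroup p V ∧ L ≤ V ⊔ Subgroup.centralizer (P : Set G) ∧
        ∀ V' ≤ L, IsFinPSubgroup p V' →
          ∃ c ∈ Subgroup.centralizer (P : Set G), conj c • V' ≤ V

theorem HasCentralizerSylow.conj_smul {P : Subgroup G} (hP : HasCentralizerSylow p P) (g : G) :
    HasCentralizerSylow p (conj g • P) := by
  intro L hCL hLN hL
  rw [centralizer_conj_smul] at hCL hL ⊢
  rw [normalizer_conj_smul] at hLN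
  obtain ⟨V, hVL, hV, hLV, hconj⟩ := hP (conj g⁻¹ • L)
    (by rwa [← conj_smul_le_iff_le_conj_inv_smul])
    (by rwa [← le_conj_smul_iff_conj_inv_smul_le])
    (by
      intro x hx
      rw [mem_conj_smul_iff, inv_inv] at hx
      obtain ⟨k, hk⟩ := hL _ hx
      refine ⟨k, ?_⟩
      rw [mem_conj_smul_iff, conj_pow] at hk
      simpa [mul_assoc] using hk)
  refine ⟨conj g • V, ?_, hV.conj_smul g, ?_, fun V' hV' hV'p => ?_⟩
  · rwa [conj_smul_le_iff_le_conj_inv_smul]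
  · rw [← Subgroup.smul_sup, le_conj_smul_iff_conj_inv_smul_le]
    exact hLV
  · obtain ⟨c, hc, h⟩ := hconj (conj g⁻¹ • V') (conj_smul_mono _ hV') (hV'p.conj_smul _)
    refine ⟨g * c * g⁻¹, mem_conj_smul_iff.2 (by simpa [mul_assoc] using hc), ?_⟩
    rw [conj_mul_smul, conj_mul_smul]
    exact conj_smul_mono g h

theorem exists_isSylowOf_of_hasCentralizerSylow [Fact p.Prime] {Q L : Subgroup G} [Finite Q]
    (hQ : HasCentralizerSylow p Q) (hC : Subgroup.centralizer (Q : Set G) ≤ L)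
    (hN : L ≤ Subgroup.normalizer (Q : Set G)) :
    ∃ V, IsSylowOf p V L ∧ ∀ D : Subgroup G, L ≤ Subgroup.normalizer (D : Set G) →
      Subgroup.centralizer (Q : Set G) ≤ D → (∀ x ∈ L, ∃ k : ℕ, x ^ p ^ k ∈ D) → L ≤ V ⊔ D := by
  let f : L →* MulAut Q := Q.normalizerMonoidHom.comp (Subgroup.inclusion hN)
  have hker : ∀ x : L, f x = 1 ↔ (x : G) ∈ Subgroup.centralizer (Q : Set G) := by
    intro x
    have h1 : f x = 1 ↔ Subgroup.inclusion hN x ∈ Q.normalizerMonoidHom.ker := Iff.rfl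
    rw [h1, Subgroup.normalizerMonoidHom_ker, Subgroup.mem_subgroupOf]
    rfl
  have : Finite (MulAut Q) := Finite.of_injective (fun e : MulAut Q => (e : Q → Q))
    DFunLike.coe_injective
  let T : Sylow p f.range := default
  let L₁ : Subgroup L := (T : Subgroup f.range).comap f.rangeRestrict
  have hidx : ¬ p ∣ L₁.index := by
    rw [Subgroup.index_comap_of_surjective _ f.rangeRestrict_surjective]
    exact T.not_dvd_index
  have hmem : ∀ x (hx : x ∈ L), x ∈ L₁.map L.subtype ↔ f.rangeRestrict ⟨x, hx⟩ ∈ T := by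
    intro x hx
    constructor
    · rintro ⟨y, hy, rfl⟩
      exact hy
    · intro h
      exact ⟨⟨x, hx⟩, h, rfl⟩
  have hL₁L : L₁.map L.subtype ≤ L := Subgroup.map_subtype_le _
  obtain ⟨V, hV, hVp, hle, hconj⟩ := hQ (L₁.map L.subtype)
    (by
      intro x hx
      rw [hmem x (hC hx)]
      have : f.rangeRestrict ⟨x, hC hx⟩ = 1 := Subtype.ext ((hker ⟨x, hC hx⟩).2 hx)
      rw [this]
      exact one_mem T)
    (hL₁L.trans hN)
    (by
      intro x hx
      have hxL := hL₁L hx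
      obtain ⟨k, hk⟩ := (isPGroup_iff_pow_pow_eq_one.1 T.2) ⟨_, (hmem x hxL).1 hx⟩
      refine ⟨k, (hker ⟨x ^ p ^ k, pow_mem hxL _⟩).1 ?_⟩
      have hk1 := congrArg (fun y : T => ((y : f.range) : MulAut Q)) hk
      have h2 : (⟨x ^ p ^ k, pow_mem hxL _⟩ : L) = ⟨x, hxL⟩ ^ p ^ k := rfl
      rw [h2, map_pow]
      exact hk1)
  refine ⟨V, ⟨hV.trans hL₁L, hVp, fun V' hV' hV'p => ?_⟩, fun D hD hCD hLD => ?_⟩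
  · have hp1 : IsPGroup p ((V'.subgroupOf L).map f.rangeRestrict) :=
      (hV'p.2.comap_subtype (K := L)).map _
    obtain ⟨T', hT'⟩ := hp1.exists_le_sylow
    obtain ⟨t, ht⟩ := MulAction.exists_smul_eq f.range T' T
    obtain ⟨l, rfl⟩ := f.rangeRestrict_surjective t
    have hl : conj (l : G) • V' ≤ L₁.map L.subtype := by
      refine conj_smul_le_iff.2 fun v hv => ?_
      have hvL := hV' hv
      rw [hmem _ (L.mul_mem (L.mul_mem l.2 hvL) (L.inv_mem l.2))]
      have h1 : f.rangeRestrict ⟨v, hvL⟩ ∈ T' := hT' ⟨⟨v, hvL⟩, hv, rfl⟩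
      have h2 : (⟨(l : G) * v * (l : G)⁻¹, L.mul_mem (L.mul_mem l.2 hvL) (L.inv_mem l.2)⟩ : L)
        = l * ⟨v, hvL⟩ * l⁻¹ := rfl
      rw [h2, map_mul, map_mul, map_inv, ← ht]
      exact Subgroup.smul_mem_pointwise_smul _ (conj (f.rangeRestrict l)) _ h1
    obtain ⟨c, hc, h⟩ := hconj _ hl (hV'p.conj_smul _)
    refine ⟨c * l, L.mul_mem (hC hc) l.2, ?_⟩
    rwa [conj_mul_smul]
  · have hn : (D.subgroupOf L).Normal := Subgroup.normal_subgroupOf_of_le_normalizer hD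
    have hq : IsPGroup p (L ⧸ D.subgroupOf L) := by
      rw [isPGroup_iff_pow_pow_eq_one]
      intro x
      obtain ⟨x, rfl⟩ := QuotientGroup.mk_surjective x
      obtain ⟨k, hk⟩ := hLD x x.2
      refine ⟨k, ?_⟩
      rw [← QuotientGroup.mk_pow, QuotientGroup.eq_one_iff, Subgroup.mem_subgroupOf]
      exact hk
    have htop := sup_eq_top_of_index hidx hq
    intro x hx
    have hxt : (⟨x, hx⟩ : L) ∈ L₁ ⊔ D.subgroupOf L := by
      rw [htop]
      trivial
    have hx2 := Subgroup.mem_map_of_mem L.subtype hxt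
    rw [Subgroup.map_sup] at hx2
    have hle2 : L₁.map L.subtype ⊔ (D.subgroupOf L).map L.subtype ≤ V ⊔ D := by
      refine sup_le (hle.trans (sup_le_sup_left hCD V)) (le_trans ?_ le_sup_right)
      rintro _ ⟨y, hy, rfl⟩
      exact hy
    exact hle2 hx2

end CentralizerSylow

section MaximalPSubgroups

variable {G : Type*} [Group G] {p : ℕ}

theorem IsFinPSubgroup.card_lt {A B : Subgroup G} (hB : IsFinPSubgroup p B) (h : A < B) :
    Nat.card A < Nat.card B := by
  have := hB.1
  refine lt_of_le_of_ne (Subgroup.card_le_of_le h.le) fun he => h.ne ?_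
  exact Subgroup.eq_of_le_of_card_ge h.le he.ge

theorem conj_smul_lt_conj_smul_iff (g : G) {A B : Subgroup G} :
    conj g • A < conj g • B ↔ A < B := by
  simp only [lt_iff_le_not_ge, Subgroup.pointwise_smul_le_pointwise_smul_iff]

/-- `T` is maximal among the finite `p`-subgroups of `N`. -/
def IsMaxPSubgroup (p : ℕ) (T N : Subgroup G) : Prop :=
  T ≤ N ∧ IsFinPSubgroup p T ∧ ∀ T' ≤ N, IsFinPSubgroup p T' → T ≤ T' → T' = T

theorem IsMaxPSubgroup.conj_smul {T N : Subgroup G} (hT : IsMaxPSubgroup p T N) {n : G}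
    (hn : n ∈ N) : IsMaxPSubgroup p (conj n • T) N := by
  refine ⟨conj_smul_le_of_le_of_mem hT.1 hn, hT.2.1.conj_smul n, fun T' hT' hT'p hle => ?_⟩
  have := hT.2.2 (conj n⁻¹ • T') (conj_smul_le_of_le_of_mem hT' (N.inv_mem hn))
    (hT'p.conj_smul _) (by rwa [← conj_smul_le_iff_le_conj_inv_smul])
  rw [← this, conj_smul_inv_smul]

theorem exists_isMaxPSubgroup_ge {N U : Subgroup G} {m : ℕ}
    (hm : ∀ V : Subgroup G, IsFinPSubgroup p V → Nat.card V ≤ m) (hU : U ≤ N)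
    (hUp : IsFinPSubgroup p U) : ∃ T, IsMaxPSubgroup p T N ∧ U ≤ T := by
  induction hk : m - Nat.card U using Nat.strong_induction_on generalizing U with
  | _ k ih =>
    by_cases h : ∃ T' ≤ N, IsFinPSubgroup p T' ∧ U < T'
    · obtain ⟨T', hT', hT'p, hlt⟩ := h
      have h1 := hT'p.card_lt hlt
      have h2 := hm T' hT'p
      obtain ⟨T, hT, hle⟩ := ih (m - Nat.card T') (by omega) hT' hT'p rfl
      exact ⟨T, hT, hlt.le.trans hle⟩
    · push Not at h
      refine ⟨U, ⟨hU, hUp, fun T' hT' hT'p hle => ?_⟩, le_rfl⟩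
      by_contra hne
      exact h T' hT' hT'p (lt_of_le_of_ne hle (Ne.symm hne))

theorem IsMaxPSubgroup.le_of_le_normalizer {T P : Subgroup G}
    (hT : IsMaxPSubgroup p T (Subgroup.normalizer (P : Set G))) (hP : IsFinPSubgroup p P) :
    P ≤ T := by
  have := hT.2.2 (T ⊔ P) (sup_le hT.1 Subgroup.le_normalizer) (hT.2.1.sup hP hT.1) le_sup_left
  rw [← this]
  exact le_sup_right

/-- Two maximal finite `p`-subgroups of `N_G(P)` that intersect in more than `P` are conjugate,
if the subgroups larger than `P` have the Sylow property for centralizers. -/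
theorem IsMaxPSubgroup.conj_of_lt_inf [Fact p.Prime] {P : Subgroup G} {m : ℕ}
    (hm : ∀ V : Subgroup G, IsFinPSubgroup p V → Nat.card V ≤ m)
    (hgood : ∀ R, P < R → IsFinPSubgroup p R → HasCentralizerSylow p R)
    {T₁ T₂ : Subgroup G} (h₁ : IsMaxPSubgroup p T₁ (Subgroup.normalizer (P : Set G)))
    (h₂ : IsMaxPSubgroup p T₂ (Subgroup.normalizer (P : Set G))) (hlt : P < T₁ ⊓ T₂) :
    ∃ n ∈ Subgroup.normalizer (P : Set G), conj n • T₁ = T₂ := by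
  induction hk : m - Nat.card (T₁ ⊓ T₂ : Subgroup G) using Nat.strong_induction_on
    generalizing T₁ T₂ with
  | _ k ih =>
    set N := Subgroup.normalizer (P : Set G) with hN
    by_cases hle₁ : T₁ ≤ T₂
    · exact ⟨1, one_mem _, by rw [conj_one_smul, h₁.2.2 T₂ h₂.1 h₂.2.1 hle₁]⟩
    by_cases hle₂ : T₂ ≤ T₁
    · exact ⟨1, one_mem _, by rw [conj_one_smul, h₂.2.2 T₁ h₁.1 h₁.2.1 hle₂]⟩
    set R := T₁ ⊓ T₂ with hR
    have hRp : IsFinPSubgroup p R := h₁.2.1.mono inf_le_left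
    have := hRp.1
    have hR₁ : R < T₁ := lt_of_le_of_ne inf_le_left fun h => hle₁ (inf_eq_left.1 h)
    have hR₂ : R < T₂ := lt_of_le_of_ne inf_le_right fun h => hle₂ (inf_eq_right.1 h)
    obtain ⟨W, hW, -⟩ := exists_isSylowOf_of_hasCentralizerSylow (hgood R hlt hRp)
      (L := Subgroup.normalizer (R : Set G) ⊓ N)
      (le_inf (Subgroup.centralizer_le_normalizer _)
        ((Subgroup.centralizer_le hlt.le).trans (Subgroup.centralizer_le_normalizer _)))
      inf_le_left
    obtain ⟨T₃, h₃, hWT⟩ := exists_isMaxPSubgroup_ge hm (hW.1.trans inf_le_right) hW.2.1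
    have step : ∀ T, IsMaxPSubgroup p T N → R < T → ∃ n ∈ N, conj n • T = T₃ := by
      intro T hT hRT
      have hlt' := hT.2.1.lt_inf_normalizer hRT
      obtain ⟨e, he, heW⟩ := hW.2.2 (T ⊓ Subgroup.normalizer (R : Set G))
        (le_inf inf_le_right (inf_le_left.trans hT.1)) (hT.2.1.mono inf_le_left)
      have hle : conj e • (T ⊓ Subgroup.normalizer (R : Set G)) ≤ conj e • T ⊓ T₃ :=
        le_inf (conj_smul_mono e inf_le_left) (heW.trans hWT)
      have hT₃p : IsFinPSubgroup p (conj e • T ⊓ T₃) := h₃.2.1.mono inf_le_right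
      have hPlt : P < conj e • T ⊓ T₃ := by
        refine lt_of_lt_of_le ?_ hle
        have : conj e • P = P := mem_normalizer_iff_conj_smul_eq.1 he.2
        rw [← this, conj_smul_lt_conj_smul_iff]
        exact hlt.trans hlt'
      have hcard : Nat.card R < Nat.card (conj e • T ⊓ T₃ : Subgroup G) := by
        have := hT₃p.1
        calc Nat.card R < Nat.card (T ⊓ Subgroup.normalizer (R : Set G) : Subgroup G) :=
              (hT.2.1.mono inf_le_left).card_lt hlt'
          _ = _ := (card_conj_smul e _).symm
          _ ≤ _ := Subgroup.card_le_of_le hle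
      obtain ⟨n, hn, h⟩ := ih _ (by have := hm _ hT₃p; omega) (hT.conj_smul he.2) h₃ hPlt rfl
      exact ⟨n * e, N.mul_mem hn he.2, by rw [conj_mul_smul, h]⟩
    obtain ⟨n₁, hn₁, e₁⟩ := step T₁ h₁ hR₁
    obtain ⟨n₂, hn₂, e₂⟩ := step T₂ h₂ hR₂
    refine ⟨n₂⁻¹ * n₁, N.mul_mem (N.inv_mem hn₂) hn₁, ?_⟩
    rw [conj_mul_smul, e₁, ← e₂, conj_inv_smul_smul]

end MaximalPSubgroups

section Normalizers

variable {G : Type*} [Group G] {p : ℕ}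

/-- One step of a gallery of `P`-fixed chambers, in terms of representatives. -/
def GalleryStep (S : Subgroup G) (𝒦 : Set (Subgroup G)) (P : Subgroup G) (a b : G) : Prop :=
  P ≤ conj b • S ∧ ∃ K ∈ 𝒦, a⁻¹ * b ∈ K

theorem conj_smul_eq_of_inv_mul_mem {a b : G} {K : Subgroup G} (h : a⁻¹ * b ∈ K) :
    conj b • K = conj a • K := by
  have : b = a * (a⁻¹ * b) := by group
  rw [this, conj_mul_smul, Subgroup.conj_smul_eq_self_of_mem h]

theorem normalizer_inf_conj_smul_lt [Fact p.Prime] {P S : Subgroup G} (hS : IsFinPSubgroup p S)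
    (hPS : ∀ x : G, ¬ conj x • S ≤ P) {x : G} (hx : P ≤ conj x • S) :
    P < Subgroup.normalizer (P : Set G) ⊓ conj x • S := by
  rw [inf_comm]
  exact (hS.conj_smul x).lt_inf_normalizer (lt_of_le_not_ge hx (hPS x))

theorem exists_isSylowOf_normalizer [Fact p.Prime] {P S : Subgroup G} {𝒦 : Set (Subgroup G)}
    (hS : IsFinPSubgroup p S)
    (hSyl : ∀ V : Subgroup G, IsFinPSubgroup p V → ∃ g : G, conj g • V ≤ S)
    (h𝒦 : ∀ K ∈ 𝒦, Finite K ∧ S ≤ K)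
    (hP : IsFinPSubgroup p P) (hPS : ∀ x : G, ¬ conj x • S ≤ P)
    (hchain : ∀ x y : G, P ≤ conj x • S → P ≤ conj y • S →
      Relation.ReflTransGen (GalleryStep S 𝒦 P) x y)
    (hgood : ∀ R, P < R → IsFinPSubgroup p R → HasCentralizerSylow p R) :
    ∃ T, IsSylowOf p T (Subgroup.normalizer (P : Set G)) := by
  set N := Subgroup.normalizer (P : Set G) with hN
  have hm : ∀ V : Subgroup G, IsFinPSubgroup p V → Nat.card V ≤ Nat.card S := by
    intro V hV
    obtain ⟨g, hg⟩ := hSyl V hV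
    have := hS.1
    rw [← card_conj_smul g V]
    exact Subgroup.card_le_of_le hg
  have hSN : ∀ x, IsFinPSubgroup p (N ⊓ conj x • S) := fun x => (hS.conj_smul x).mono inf_le_right
  obtain ⟨g₀, hg₀⟩ := hSyl P hP
  have hx₀ : P ≤ conj g₀⁻¹ • S := by rwa [← conj_smul_le_iff_le_conj_inv_smul]
  obtain ⟨T₀, hT₀, hle₀⟩ := exists_isMaxPSubgroup_ge hm inf_le_left (hSN g₀⁻¹)
  have key : ∀ x, Relation.ReflTransGen (GalleryStep S 𝒦 P) g₀⁻¹ x → P ≤ conj x • S ∧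
      ∀ T, IsMaxPSubgroup p T N → N ⊓ conj x • S ≤ T → ∃ n ∈ N, conj n • T = T₀ := by
    intro x hx
    induction hx with
    | refl =>
      refine ⟨hx₀, fun T hT hle => ?_⟩
      exact hT.conj_of_lt_inf hm hgood hT₀
        ((normalizer_inf_conj_smul_lt hS hPS hx₀).trans_le (le_inf hle hle₀))
    | @tail x y _ hxy ih =>
      obtain ⟨hPx, ih⟩ := ih
      obtain ⟨hPy, K, hK, hk⟩ := hxy
      refine ⟨hPy, fun T hT hle => ?_⟩
      have := (h𝒦 K hK).1
      have : Finite (conj x • K : Subgroup G) :=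
        Finite.of_equiv _ (Subgroup.equivSMul (conj x) K).toEquiv
      have : Finite (N ⊓ conj x • K : Subgroup G) := finite_of_le inf_le_right
      obtain ⟨W, hW, hxW⟩ := exists_isSylowOf_ge
        (inf_le_inf_left N (conj_smul_mono x (h𝒦 K hK).2)) (hSN x).2
      have hyE : N ⊓ conj y • S ≤ N ⊓ conj x • K := by
        rw [← conj_smul_eq_of_inv_mul_mem hk]
        exact inf_le_inf_left N (conj_smul_mono y (h𝒦 K hK).2)
      obtain ⟨e, he, heW⟩ := hW.2.2 _ hyE (hSN y)
      obtain ⟨T', hT', hWT'⟩ := exists_isMaxPSubgroup_ge hm (hW.1.trans inf_le_left) hW.2.1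
      obtain ⟨n, hn, hnT⟩ := ih T' hT' (hxW.trans hWT')
      have hlt : P < conj e • T ⊓ T' := by
        refine lt_of_lt_of_le ?_
          (le_inf (conj_smul_mono e hle) (heW.trans hWT'))
        have : conj e • P = P := mem_normalizer_iff_conj_smul_eq.1 he.1
        rw [← this, conj_smul_lt_conj_smul_iff]
        exact normalizer_inf_conj_smul_lt hS hPS hPy
      obtain ⟨n', hn', h'⟩ := (hT.conj_smul he.1).conj_of_lt_inf hm hgood hT' hlt
      refine ⟨n * (n' * e), N.mul_mem hn (N.mul_mem hn' he.1), ?_⟩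
      rw [conj_mul_smul, conj_mul_smul, h', hnT]
  refine ⟨T₀, hT₀.1, hT₀.2.1, fun V hV hVp => ?_⟩
  obtain ⟨T, hT, hVT⟩ := exists_isMaxPSubgroup_ge hm hV hVp
  obtain ⟨g, hg⟩ := hSyl T hT.2.1
  have hTg : T ≤ conj g⁻¹ • S := by rwa [← conj_smul_le_iff_le_conj_inv_smul]
  have hPg : P ≤ conj g⁻¹ • S := (hT.le_of_le_normalizer hP).trans hTg
  obtain ⟨n, hn, hnT⟩ := (key _ (hchain _ _ hx₀ hPg)).2 T hT
    (hT.2.2 _ inf_le_left (hSN _) (le_inf hT.1 hTg)).le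
  exact ⟨n, hn, hnT ▸ conj_smul_mono n hVT⟩

/-- The subgroup of `N_G(P)` that is generated by `C_G(P)` and the elements which conjugate some
subgroup of `T` larger than `P` to a subgroup of `T`. -/
def extendingSubgroup (P T : Subgroup G) : Subgroup G :=
  Subgroup.closure ({g | g ∈ Subgroup.normalizer (P : Set G) ∧
    ∃ Q, P < Q ∧ Q ≤ T ∧ conj g • Q ≤ T} ∪ Subgroup.centralizer (P : Set G))

theorem mem_extendingSubgroup {P T Q : Subgroup G} {g : G}
    (hg : g ∈ Subgroup.normalizer (P : Set G)) (hPQ : P < Q) (hQT : Q ≤ T)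
    (hgQ : conj g • Q ≤ T) : g ∈ extendingSubgroup P T :=
  Subgroup.subset_closure (Or.inl ⟨hg, Q, hPQ, hQT, hgQ⟩)

theorem centralizer_le_extendingSubgroup (P T : Subgroup G) :
    Subgroup.centralizer (P : Set G) ≤ extendingSubgroup P T :=
  fun _ hx => Subgroup.subset_closure (Or.inr hx)

theorem normalizer_le_extendingSubgroup [Fact p.Prime] {P S T : Subgroup G}
    {𝒦 : Set (Subgroup G)} (hS : IsFinPSubgroup p S)
    (hSyl : ∀ V : Subgroup G, IsFinPSubgroup p V → ∃ g : G, conj g • V ≤ S)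
    (h𝒦 : ∀ K ∈ 𝒦, Finite K ∧ S ≤ K)
    (hPS : ∀ x : G, ¬ conj x • S ≤ P)
    (hchain : ∀ x y : G, P ≤ conj x • S → P ≤ conj y • S →
      Relation.ReflTransGen (GalleryStep S 𝒦 P) x y)
    (hT : IsSylowOf p T (Subgroup.normalizer (P : Set G))) (hPT : P ≤ T)
    (hlocal : ∀ K ∈ 𝒦, ∀ (x : G) (W : Subgroup G),
      IsSylowOf p W (Subgroup.normalizer (P : Set G) ⊓ conj x • K) → P < W → W ≤ T →
        Subgroup.normalizer (P : Set G) ⊓ conj x • K ≤ extendingSubgroup P T) :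
    Subgroup.normalizer (P : Set G) ≤ extendingSubgroup P T := by
  set N := Subgroup.normalizer (P : Set G) with hN
  set M := extendingSubgroup P T with hM
  have hSN : ∀ x, IsFinPSubgroup p (N ⊓ conj x • S) := fun x => (hS.conj_smul x).mono inf_le_right
  obtain ⟨g₀, hg₀⟩ := hSyl T hT.2.1
  have hTx₀ : T ≤ conj g₀⁻¹ • S := by rwa [← conj_smul_le_iff_le_conj_inv_smul]
  have hTeq : N ⊓ conj g₀⁻¹ • S = T := by
    have := (hSN g₀⁻¹).1
    exact (Subgroup.eq_of_le_of_card_ge (le_inf hT.1 hTx₀) (hT.card_le inf_le_left (hSN _))).symm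
  have hlt := fun {x : G} => normalizer_inf_conj_smul_lt (x := x) hS hPS
  have hPconj : ∀ n ∈ N, conj n • P = P := fun n hn => mem_normalizer_iff_conj_smul_eq.1 hn
  have hsame : ∀ U, P < U → ∀ n ∈ N, ∀ n' ∈ N, conj n • U ≤ T → conj n' • U ≤ T →
      n ∈ M → n' ∈ M := by
    intro U hU n hn n' hn' h h' hnM
    have h1 : n' * n⁻¹ ∈ M := by
      refine mem_extendingSubgroup (N.mul_mem hn' (N.inv_mem hn)) (Q := conj n • U) ?_ h ?_
      · rw [← hPconj n hn, conj_smul_lt_conj_smul_iff]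
        exact hU
      · rwa [conj_mul_smul, conj_inv_smul_smul]
    have := M.mul_mem h1 hnM
    simpa using this
  have key : ∀ x, Relation.ReflTransGen (GalleryStep S 𝒦 P) g₀⁻¹ x → P ≤ conj x • S ∧
      ∀ n ∈ N, conj n • (N ⊓ conj x • S) ≤ T → n ∈ M := by
    intro x hx
    induction hx with
    | refl =>
      refine ⟨hPT.trans hTx₀, fun n hn hle => ?_⟩
      exact hsame _ (hlt (hPT.trans hTx₀)) 1 (one_mem _) n hn (by rw [conj_one_smul, hTeq]) hle
        (one_mem _)
    | @tail x y _ hxy ih =>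
      obtain ⟨hPx, ih⟩ := ih
      obtain ⟨hPy, K, hK, hk⟩ := hxy
      refine ⟨hPy, fun n hn hle => ?_⟩
      have := (h𝒦 K hK).1
      have : Finite (conj x • K : Subgroup G) :=
        Finite.of_equiv _ (Subgroup.equivSMul (conj x) K).toEquiv
      have : Finite (N ⊓ conj x • K : Subgroup G) := finite_of_le inf_le_right
      obtain ⟨W, hW, hxW⟩ := exists_isSylowOf_ge
        (inf_le_inf_left N (conj_smul_mono x (h𝒦 K hK).2)) (hSN x).2
      have hyE : N ⊓ conj y • S ≤ N ⊓ conj x • K := by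
        rw [← conj_smul_eq_of_inv_mul_mem hk]
        exact inf_le_inf_left N (conj_smul_mono y (h𝒦 K hK).2)
      obtain ⟨e, he, heW⟩ := hW.2.2 _ hyE (hSN y)
      obtain ⟨m, hm, hmW⟩ := hT.2.2 W (hW.1.trans inf_le_left) hW.2.1
      have hmM : m ∈ M := ih m hm ((conj_smul_mono m hxW).trans hmW)
      have hPW : P < W := (hlt hPx).trans_le hxW
      have hEconj : conj m • (N ⊓ conj x • K) = N ⊓ conj (m * x) • K := by
        rw [Subgroup.smul_inf, Subgroup.conj_smul_eq_self_of_mem hm, conj_mul_smul]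
      have hmE : N ⊓ conj (m * x) • K ≤ M := by
        refine hlocal K hK (m * x) (conj m • W) ?_ ?_ hmW
        · rw [← hEconj]
          refine ⟨conj_smul_mono m hW.1, hW.2.1.conj_smul m, fun V hV hVp => ?_⟩
          obtain ⟨f, hf, hfW⟩ := hW.2.2 (conj m⁻¹ • V)
            (by rwa [← le_conj_smul_iff_conj_inv_smul_le]) (hVp.conj_smul _)
          refine ⟨m * f * m⁻¹, mem_conj_smul_iff.2 (by simpa [mul_assoc] using hf), ?_⟩
          rw [conj_mul_smul, conj_mul_smul]
          exact conj_smul_mono m hfW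
        · rw [← hPconj m hm, conj_smul_lt_conj_smul_iff]
          exact hPW
      have hmeM : m * e ∈ M := by
        have h1 : m * e * m⁻¹ ∈ M := by
          apply hmE
          rw [← hEconj, mem_conj_smul_iff]
          simpa [mul_assoc] using he
        have := M.mul_mem h1 hmM
        simpa using this
      refine hsame _ (hlt hPy) (m * e) (N.mul_mem hm he.1) n hn ?_ hle hmeM
      exact conj_mul_smul_le heW hmW
  intro g hg
  have hTg : conj g⁻¹ • (N ⊓ conj (g * g₀⁻¹) • S) = T := by
    rw [Subgroup.smul_inf, Subgroup.conj_smul_eq_self_of_mem (N.inv_mem hg), ← conj_mul_smul,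
      inv_mul_cancel_left, hTeq]
  have hPg : P ≤ conj (g * g₀⁻¹) • S := by
    rw [← hPconj g hg, conj_mul_smul]
    exact conj_smul_mono g (hPT.trans hTx₀)
  have := (key _ (hchain _ _ (hPT.trans hTx₀) hPg)).2 g⁻¹ (N.inv_mem hg) hTg.le
  simpa using M.inv_mem this

theorem extendingSubgroup_le [Fact p.Prime] {P T : Subgroup G}
    (hgood : ∀ R, P < R → IsFinPSubgroup p R → HasCentralizerSylow p R)
    (hT : IsSylowOf p T (Subgroup.normalizer (P : Set G))) :
    extendingSubgroup P T ≤ (Subgroup.normalizer (P : Set G) ⊓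
      Subgroup.normalizer ((T ⊓ Subgroup.centralizer (P : Set G) : Subgroup G) : Set G)) ⊔
        Subgroup.centralizer (P : Set G) := by
  set N := Subgroup.normalizer (P : Set G) with hN
  set C := Subgroup.centralizer (P : Set G) with hC
  set D := T ⊓ C with hD
  set A := (N ⊓ Subgroup.normalizer (D : Set G)) ⊔ C with hA
  have hNC : N ≤ Subgroup.normalizer (C : Set G) := normalizer_le_normalizer_centralizer P
  have hTD : T ≤ Subgroup.normalizer (D : Set G) := by
    intro t ht
    rw [mem_normalizer_iff_conj_smul_eq, hD, Subgroup.smul_inf,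
      Subgroup.conj_smul_eq_self_of_mem ht, mem_normalizer_iff_conj_smul_eq.1 (hNC (hT.1 ht))]
  have hTA : T ≤ A := (le_inf hT.1 hTD).trans le_sup_left
  have hCA : C ≤ A := le_sup_right
  have hCN : C ≤ N := Subgroup.centralizer_le_normalizer _
  have hDp : IsFinPSubgroup p D := hT.2.1.mono inf_le_left
  have := hDp.1
  have hconjC : ∀ n ∈ N, conj n • C = C := fun n hn => mem_normalizer_iff_conj_smul_eq.1 (hNC hn)
  suffices h : ∀ k, ∀ Q g, P < Q → Q ≤ T → g ∈ N → conj g • Q ≤ T →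
      Nat.card T - Nat.card Q = k → g ∈ A by
    refine (Subgroup.closure_le _).2 (Set.union_subset ?_ hCA)
    rintro g ⟨hg, Q, hPQ, hQT, hgQ⟩
    exact h _ Q g hPQ hQT hg hgQ rfl
  intro k
  induction k using Nat.strong_induction_on with
  | _ k ih =>
    intro Q g hPQ hQT hg hgQ hk
    by_cases hDQ : D ≤ Q
    · have h1 : conj g • D ≤ D := by
        refine le_inf ((conj_smul_mono g hDQ).trans hgQ) ?_
        rw [← hconjC g hg]
        exact conj_smul_mono g inf_le_right
      exact Subgroup.mem_sup_left ⟨hg, mem_normalizer_of_conj_smul_le h1⟩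
    have hDQ' : ¬ D ≤ conj g • Q := by
      intro h
      have h0 : conj g⁻¹ • D ≤ Q := by rwa [← le_conj_smul_iff_conj_inv_smul_le]
      have h1 : conj g⁻¹ • D ≤ D := by
        refine le_inf (h0.trans hQT) ?_
        rw [← hconjC g⁻¹ (N.inv_mem hg)]
        exact conj_smul_mono g⁻¹ inf_le_right
      rw [mem_normalizer_iff_conj_smul_eq.1 (mem_normalizer_of_conj_smul_le h1)] at h0
      exact hDQ h0
    have hPQ' : P < conj g • Q := by
      rw [← mem_normalizer_iff_conj_smul_eq.1 hg, conj_smul_lt_conj_smul_iff]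
      exact hPQ
    have hgrow : ∀ Q ≤ T, ¬ D ≤ Q → Q < (Q ⊔ D) ⊓ Subgroup.normalizer (Q : Set G) := by
      intro Q hQT hDQ
      exact (hT.2.1.mono (sup_le hQT inf_le_left)).lt_inf_normalizer
        (lt_of_le_of_ne le_sup_left fun h => hDQ (h ▸ le_sup_right))
    have hlt := hgrow Q hQT hDQ
    have hlt' := hgrow _ hgQ hDQ'
    have hle : ∀ Q ≤ T, (Q ⊔ D) ⊓ Subgroup.normalizer (Q : Set G) ≤ T := fun Q hQ =>
      inf_le_left.trans (sup_le hQ inf_le_left)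
    have hQp' : IsFinPSubgroup p (conj g • Q) := hT.2.1.mono hgQ
    have := hQp'.1
    have hCQ : Subgroup.centralizer ((conj g • Q : Subgroup G) : Set G) ≤ C :=
      Subgroup.centralizer_le hPQ'.le
    set L := Subgroup.normalizer ((conj g • Q : Subgroup G) : Set G) ⊓ (conj g • Q ⊔ C) with hL
    obtain ⟨W, hW, -⟩ := exists_isSylowOf_of_hasCentralizerSylow (hgood _ hPQ' hQp') (L := L)
      (le_inf (Subgroup.centralizer_le_normalizer _) (hCQ.trans le_sup_right)) inf_le_left
    have hLA : L ≤ A := inf_le_right.trans (sup_le (hgQ.trans hTA) hCA)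
    have hLN : L ≤ N := inf_le_right.trans (sup_le (hgQ.trans hT.1) hCN)
    obtain ⟨l, hl, hlW⟩ := hW.2.2
      (conj g • ((Q ⊔ D) ⊓ Subgroup.normalizer (Q : Set G)))
      (by
        rw [hL, Subgroup.smul_inf, ← normalizer_conj_smul, inf_comm, Subgroup.smul_sup]
        refine inf_le_inf_left _ (sup_le_sup_left ?_ _)
        rw [← hconjC g hg]
        exact conj_smul_mono g inf_le_right)
      ((hT.2.1.mono (hle Q hQT)).conj_smul g)
    obtain ⟨l', hl', hlW'⟩ := hW.2.2
      ((conj g • Q ⊔ D) ⊓ Subgroup.normalizer ((conj g • Q : Subgroup G) : Set G))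
      (by
        rw [hL, inf_comm]
        exact inf_le_inf_left _ (sup_le_sup_left inf_le_right _))
      (hT.2.1.mono (hle _ hgQ))
    obtain ⟨t, ht, htW⟩ := hT.2.2 W (hW.1.trans hLN) hW.2.1
    have hTfin := hT.2.1.1
    have c1 := (hT.2.1.mono (hle Q hQT)).card_lt hlt
    have c2 := (hT.2.1.mono (hle _ hgQ)).card_lt hlt'
    have c3 := Subgroup.card_le_of_le (hle Q hQT)
    have c4 := Subgroup.card_le_of_le (hle _ hgQ)
    rw [card_conj_smul] at c2
    have a1 : t * (l * g) ∈ A := by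
      refine ih _ ?_ _ _ (hPQ.trans hlt) (hle Q hQT)
        (N.mul_mem ht (N.mul_mem (hLN hl) hg)) ?_ rfl
      · omega
      · refine conj_mul_smul_le (le_trans ?_ hlW) htW
        rw [conj_mul_smul]
    have a2 : t * l' ∈ A := by
      refine ih _ ?_ _ _ (hPQ'.trans hlt') (hle _ hgQ)
        (N.mul_mem ht (hLN hl')) (conj_mul_smul_le hlW' htW) rfl
      omega
    have a3 : l'⁻¹ * l ∈ A := hLA (L.mul_mem (L.inv_mem hl') hl)
    have := A.mul_mem (A.inv_mem (A.mul_mem a2 a3)) a1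
    simpa [mul_assoc] using this

/-- If `T` is a Sylow subgroup of `N_G(P)` with `C_T(P) ≰ P`, and `N_G(P)` is the product of
`C_G(P)` and the normalizer of `C_T(P)`, then `P` inherits the Sylow property for centralizers
from `P C_T(P)`. -/
theorem hasCentralizerSylow_of_normalizer_le [Fact p.Prime] {P T : Subgroup G}
    (hP : IsFinPSubgroup p P)
    (hgood : ∀ R, P < R → IsFinPSubgroup p R → HasCentralizerSylow p R)
    (hT : IsSylowOf p T (Subgroup.normalizer (P : Set G)))
    (hTP : ¬ T ⊓ Subgroup.centralizer (P : Set G) ≤ P)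
    (hfac : Subgroup.normalizer (P : Set G) ≤ (Subgroup.normalizer (P : Set G) ⊓
      Subgroup.normalizer ((T ⊓ Subgroup.centralizer (P : Set G) : Subgroup G) : Set G)) ⊔
        Subgroup.centralizer (P : Set G)) : HasCentralizerSylow p P := by
  set N := Subgroup.normalizer (P : Set G) with hN
  set C := Subgroup.centralizer (P : Set G) with hC
  set D := T ⊓ C with hD
  have hNC : N ≤ Subgroup.normalizer (C : Set G) := normalizer_le_normalizer_centralizer P
  have hTD : T ≤ Subgroup.normalizer (D : Set G) := by
    intro t ht
    rw [mem_normalizer_iff_conj_smul_eq, hD, Subgroup.smul_inf,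
      Subgroup.conj_smul_eq_self_of_mem ht, mem_normalizer_iff_conj_smul_eq.1 (hNC (hT.1 ht))]
  have hDp : IsFinPSubgroup p D := hT.2.1.mono inf_le_left
  have hQp : IsFinPSubgroup p (D ⊔ P) := hDp.sup hP (inf_le_left.trans hT.1)
  have hPQ : P < D ⊔ P := lt_of_le_of_ne le_sup_right fun h => hTP (h ▸ le_sup_left)
  have hNQ : N ⊓ Subgroup.normalizer (D : Set G) ≤
      Subgroup.normalizer ((D ⊔ P : Subgroup G) : Set G) := by
    rw [sup_comm]
    exact Subgroup.normalizer_inf_normalizer_le_normalizer_sup P D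
  have hNfac : N ⊓ Subgroup.normalizer (D : Set G) ≤ Subgroup.normalizer (C : Set G) :=
    inf_le_left.trans hNC
  intro L hCL hLN hL
  have := hQp.1
  have hCQC : Subgroup.centralizer ((D ⊔ P : Subgroup G) : Set G) ≤ C :=
    Subgroup.centralizer_le hPQ.le
  set LQ := L ⊓ Subgroup.normalizer ((D ⊔ P : Subgroup G) : Set G) with hLQ
  obtain ⟨V, hV, hVsup⟩ := exists_isSylowOf_of_hasCentralizerSylow (hgood _ hPQ hQp) (L := LQ)
    (le_inf (hCQC.trans hCL) (Subgroup.centralizer_le_normalizer _)) inf_le_right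
  have hVC : LQ ≤ V ⊔ C := hVsup C (inf_le_left.trans (hLN.trans hNC)) hCQC
    fun x hx => hL x hx.1
  refine ⟨V, hV.1.trans inf_le_left, hV.2.1, ?_, fun V' hV' hV'p => ?_⟩
  · intro l hl
    obtain ⟨a, ha, c, hc, rfl⟩ := (mem_sup_iff_of_le_normalizer hNfac).1 (hfac (hLN hl))
    have haL : a ∈ L := by simpa using L.mul_mem hl (L.inv_mem (hCL hc))
    exact mul_mem (hVC ⟨haL, hNQ ha⟩) (Subgroup.mem_sup_right hc)
  · obtain ⟨n, hn, hnT⟩ := hT.2.2 V' (hV'.trans hLN) hV'p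
    obtain ⟨a, ha, c, hc, rfl⟩ := (mem_sup_iff_of_le_normalizer hNfac).1 (hfac hn)
    have hcV : conj c • V' ≤ LQ := by
      refine le_inf (conj_smul_le_of_le_of_mem hV' (hCL hc)) ?_
      have h1 : conj a • conj c • V' ≤ Subgroup.normalizer ((D ⊔ P : Subgroup G) : Set G) := by
        rw [← conj_mul_smul]
        exact hnT.trans ((le_inf hT.1 hTD).trans hNQ)
      have h2 := conj_smul_le_of_le_of_mem h1 (Subgroup.inv_mem _ (hNQ ha))
      rwa [conj_inv_smul_smul] at h2
    obtain ⟨l, hl, hlV⟩ := hV.2.2 _ hcV (hV'p.conj_smul c)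
    obtain ⟨v, hv, c₂, hc₂, rfl⟩ := (mem_sup_iff_of_le_normalizer
      (hV.1.trans (inf_le_left.trans (hLN.trans hNC)))).1 (hVC hl)
    refine ⟨c₂ * c, C.mul_mem hc₂ hc, ?_⟩
    have h2 := conj_smul_le_of_le_of_mem hlV (V.inv_mem hv)
    rwa [← conj_mul_smul, ← conj_mul_smul, ← mul_assoc, inv_mul_cancel, one_mul] at h2

end Normalizers

section FusionOf

variable {G : Type*} [Group G] {p : ℕ} {S K : Subgroup G} {hSK : S ≤ K}

theorem map_imageIn {P Q : Subgroup S} {φ : P →* Q} {g : G}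
    (h : ∀ x : P, ((φ x : S) : G) = g * ((x : S) : G) * g⁻¹) :
    (imageIn φ).map S.subtype = conj g • P.map S.subtype := by
  ext y
  rw [mem_conj_smul_iff]
  constructor
  · rintro ⟨_, ⟨x, rfl⟩, rfl⟩
    refine ⟨x, x.2, ?_⟩
    change ((x : S) : G) = g⁻¹ * ((φ x : S) : G) * g
    rw [h x]
    group
  · rintro ⟨x, hx, hxy⟩
    refine ⟨φ ⟨x, hx⟩, ⟨⟨x, hx⟩, rfl⟩, ?_⟩
    change ((φ ⟨x, hx⟩ : S) : G) = y
    rw [h ⟨x, hx⟩]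
    change g * S.subtype x * g⁻¹ = y
    rw [hxy]
    group

theorem exists_hom_of_conj_smul_le (P Q : Subgroup S) {g : G} (hg : g ∈ K)
    (h : conj g • P.map S.subtype ≤ Q.map S.subtype) :
    ∃ φ ∈ (fusionOf S K hSK).Hom P Q, ∀ x : P, ((φ x : S) : G) = g * ((x : S) : G) * g⁻¹ := by
  have hmem : ∀ x : P, ∃ y : Q, ((y : S) : G) = g * ((x : S) : G) * g⁻¹ := by
    intro x
    obtain ⟨y, hy, hyx⟩ := conj_smul_le_iff.1 h _ (Subgroup.mem_map_of_mem S.subtype x.2)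
    exact ⟨⟨y, hy⟩, hyx⟩
  choose f hf using hmem
  let φ : P →* Q := MonoidHom.mk' f fun a b => by
    apply Subtype.ext
    apply Subtype.ext
    have h1 : (((f a * f b : Q) : S) : G) = ((f a : S) : G) * ((f b : S) : G) := rfl
    have h2 : (((a * b : P) : S) : G) = ((a : S) : G) * ((b : S) : G) := rfl
    rw [hf, h1, hf, hf, h2]
    group
  exact ⟨φ, ⟨g, hg, hf⟩, hf⟩

theorem map_centralizer (X : Subgroup S) :
    (Subgroup.centralizer (X : Set S)).map S.subtype =
      S ⊓ Subgroup.centralizer (X.map S.subtype : Set G) := by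
  ext y
  constructor
  · rintro ⟨s, hs, rfl⟩
    refine ⟨s.2, ?_⟩
    rintro _ ⟨x, hx, rfl⟩
    exact congrArg Subtype.val (hs x hx)
  · rintro ⟨hyS, hy⟩
    refine ⟨⟨y, hyS⟩, fun x hx => Subtype.ext ?_, rfl⟩
    exact hy _ ⟨x, hx, rfl⟩

theorem map_normalizer (X : Subgroup S) :
    (Subgroup.normalizer (X : Set S)).map S.subtype =
      S ⊓ Subgroup.normalizer (X.map S.subtype : Set G) := by
  have hX : ∀ x : S, (x : G) ∈ X.map S.subtype ↔ x ∈ X := fun x =>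
    Subgroup.mem_map_iff_mem S.subtype_injective
  ext y
  constructor
  · rintro ⟨s, hs, rfl⟩
    refine ⟨s.2, Subgroup.mem_normalizer_iff.2 fun x => ?_⟩
    have hs := Subgroup.mem_normalizer_iff.1 hs
    constructor
    · rintro ⟨x, hx, rfl⟩
      exact (hX (s * x * s⁻¹)).2 ((hs x).1 hx)
    · rintro ⟨z, hz, hzx⟩
      have hx : x = ((s⁻¹ * z * s : S) : G) := by
        change _ = (s : G)⁻¹ * S.subtype z * s
        rw [hzx]
        simp [mul_assoc]
      rw [hx, hX, hs]
      simpa [mul_assoc] using hz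
  · rintro ⟨hyS, hy⟩
    refine ⟨⟨y, hyS⟩, Subgroup.mem_normalizer_iff.2 fun x => ?_, rfl⟩
    rw [← hX, ← hX]
    exact Subgroup.mem_normalizer_iff.1 hy x

theorem card_map_subtype (X : Subgroup S) : Nat.card (X.map S.subtype) = Nat.card X :=
  (Nat.card_congr (Subgroup.equivMapOfInjective X S.subtype S.subtype_injective).toEquiv).symm

theorem centralizer_eq_map_center_iff {H : Type*} [Group H] (X : Subgroup H) :
    Subgroup.centralizer (X : Set H) = (Subgroup.center X).map X.subtype ↔
      Subgroup.centralizer (X : Set H) ≤ X := by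
  constructor
  · intro h
    rw [h]
    exact Subgroup.map_subtype_le _
  · intro h
    ext y
    constructor
    · intro hy
      refine ⟨⟨y, h hy⟩, Subgroup.mem_center_iff.2 fun x => Subtype.ext ?_, rfl⟩
      exact hy x x.2
    · rintro ⟨z, hz, rfl⟩ x hx
      exact congrArg Subtype.val (Subgroup.mem_center_iff.1 hz ⟨x, hx⟩)

theorem centric_fusionOf_iff {P : Subgroup S} :
    (fusionOf S K hSK).Centric P ↔ ∀ k ∈ K, conj k • P.map S.subtype ≤ S →
      S ⊓ Subgroup.centralizer ((conj k • P.map S.subtype : Subgroup G) : Set G) ≤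
        conj k • P.map S.subtype := by
  have key : ∀ (φ : P →* (⊤ : Subgroup S)) (g : G),
      (∀ x : P, ((φ x : S) : G) = g * ((x : S) : G) * g⁻¹) →
      (Subgroup.centralizer (imageIn φ : Set S) =
        (Subgroup.center (imageIn φ)).map (imageIn φ).subtype ↔
      S ⊓ Subgroup.centralizer ((conj g • P.map S.subtype : Subgroup G) : Set G) ≤
        conj g • P.map S.subtype) := by
    intro φ g h
    rw [centralizer_eq_map_center_iff, ← map_imageIn h, ← map_centralizer,
      Subgroup.map_le_map_iff_of_injective S.subtype_injective]
  constructor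
  · intro h k hk hle
    obtain ⟨φ, hφ, hφk⟩ := exists_hom_of_conj_smul_le (hSK := hSK) P ⊤ hk
      (by rwa [← MonoidHom.range_eq_map, Subgroup.range_subtype])
    exact (key φ k hφk).1 (h φ hφ)
  · rintro h φ ⟨g, hg, hφ⟩
    refine (key φ g hφ).2 (h g hg ?_)
    rw [← map_imageIn hφ]
    exact Subgroup.map_subtype_le _

/-- Every finite `p`-subgroup of `C_G(P)` lies in `P`. -/
def IsPCentric (p : ℕ) (P : Subgroup G) : Prop :=
  ∀ V ≤ Subgroup.centralizer (P : Set G), IsFinPSubgroup p V → V ≤ P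

theorem IsPCentric.conj_smul {P : Subgroup G} (hP : IsPCentric p P) (g : G) :
    IsPCentric p (conj g • P) := by
  intro V hV hVp
  rw [centralizer_conj_smul, le_conj_smul_iff_conj_inv_smul_le] at hV
  rw [le_conj_smul_iff_conj_inv_smul_le]
  exact hP _ hV (hVp.conj_smul _)

theorem isPCentric_iff_centric {P : Subgroup S} (hS : IsFinPSubgroup p S)
    (hSyl : ∀ V : Subgroup G, IsFinPSubgroup p V → ∃ g : G, conj g • V ≤ S) :
    IsPCentric p (P.map S.subtype) ↔ (fusionOf S ⊤ le_top).Centric P := by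
  rw [centric_fusionOf_iff]
  constructor
  · intro h k _ _
    exact h.conj_smul k _ inf_le_right (hS.mono inf_le_left)
  · intro h V hV hVp
    have hPp : IsFinPSubgroup p (P.map S.subtype) := hS.mono (Subgroup.map_subtype_le P)
    obtain ⟨g, hg⟩ := hSyl _ (hVp.sup hPp (hV.trans (Subgroup.centralizer_le_normalizer _)))
    rw [Subgroup.smul_sup, sup_le_iff] at hg
    have := h g trivial hg.2
    rw [centralizer_conj_smul] at this
    exact Subgroup.pointwise_smul_le_pointwise_smul_iff.1
      ((le_inf hg.1 (conj_smul_mono g hV)).trans this)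

/-- If a subgroup `M` of `G` contains `C_K(P)` and every element of `N_K(P)` that conjugates some
subgroup of a Sylow subgroup `W` of `N_K(P)` larger than `P` into `W`, but does not contain
`N_K(P)`, then `P` is essential in the fusion system of `K`. -/
theorem essential_of_not_normalizer_le [Fact p.Prime] [Finite K] {P W M : Subgroup G}
    (hS : IsFinPSubgroup p S)
    (hW : IsSylowOf p W (Subgroup.normalizer (P : Set G) ⊓ K)) (hPW : P < W) (hWS : W ≤ S)
    (hCM : Subgroup.centralizer (P : Set G) ⊓ K ≤ M)
    (hM : ∀ g ∈ Subgroup.normalizer (P : Set G) ⊓ K, ∀ Q, P < Q → Q ≤ W → conj g • Q ≤ W → g ∈ M)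
    (hnot : ¬ Subgroup.normalizer (P : Set G) ⊓ K ≤ M) :
    (fusionOf S K hSK).Essential p (P.subgroupOf S) := by
  set E := Subgroup.normalizer (P : Set G) ⊓ K with hE
  set C := Subgroup.centralizer (P : Set G) with hC
  have hPS : P ≤ S := hPW.le.trans hWS
  have hmapP : (P.subgroupOf S).map S.subtype = P := by
    rw [Subgroup.map_subgroupOf_eq_of_le hPS]
  have : Finite E := finite_of_le inf_le_right
  have hPp : IsFinPSubgroup p P := hS.mono hPS
  have := hPp.1
  have hEC : E ≤ Subgroup.normalizer (C : Set G) :=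
    inf_le_left.trans (normalizer_le_normalizer_centralizer P)
  have hEP : ∀ e ∈ E, conj e • P = P := fun e he => mem_normalizer_iff_conj_smul_eq.1 he.1
  have hCE : C ⊓ K ≤ E := inf_le_inf_right K (Subgroup.centralizer_le_normalizer _)
  have hECM : E ⊓ C ≤ M := fun x hx => hCM ⟨hx.2, hx.1.2⟩
  have hWM : W ≤ M := fun w hw => hM w (hW.1 hw) W hPW le_rfl
    (conj_smul_le_of_le_of_mem le_rfl hw)
  have hWC : W ⊓ C ≤ P := by
    by_contra hcon
    refine hnot fun e he => ?_
    have hsyl := hW.inf hEC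
    obtain ⟨c, hc, hcW⟩ := hsyl.2.2 (conj e • (W ⊓ C)) (by
      exact le_inf (conj_smul_le_of_le_of_mem (inf_le_left.trans hW.1) he)
        ((conj_smul_mono e inf_le_right).trans (mem_normalizer_iff_conj_smul_eq.1 (hEC he)).le))
      ((hW.2.1.mono inf_le_left).conj_smul e)
    have hce : c * e ∈ M := by
      refine hM _ (E.mul_mem hc.1 he) ((W ⊓ C) ⊔ P) ?_ (sup_le inf_le_left hPW.le) ?_
      · exact lt_of_le_of_ne le_sup_right fun h => hcon (h ▸ le_sup_left)
      · rw [Subgroup.smul_sup, hEP _ (E.mul_mem hc.1 he), conj_mul_smul]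
        exact sup_le (hcW.trans inf_le_left) hPW.le
    simpa using M.mul_mem (M.inv_mem (hECM hc)) hce
  refine ⟨?_, ?_⟩
  · rw [centric_fusionOf_iff, hmapP]
    intro k hk _
    have h1 : conj k⁻¹ • (S ⊓ Subgroup.centralizer ((conj k • P : Subgroup G) : Set G)) ≤
        C ⊓ K := by
      rw [centralizer_conj_smul, Subgroup.smul_inf, conj_inv_smul_smul, inf_comm]
      exact inf_le_inf_left _ (conj_smul_le_of_le_of_mem hSK (K.inv_mem hk))
    obtain ⟨e, he, heW⟩ := hW.2.2 _ (h1.trans hCE) ((hS.mono inf_le_left).conj_smul _)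
    have h2 : conj e • conj k⁻¹ • (S ⊓ Subgroup.centralizer ((conj k • P : Subgroup G) : Set G)) ≤
        conj e • P := by
      rw [hEP e he]
      refine (le_inf heW ?_).trans hWC
      rw [← mem_normalizer_iff_conj_smul_eq.1 (hEC he)]
      exact conj_smul_mono e (h1.trans inf_le_left)
    rw [le_conj_smul_iff_conj_inv_smul_le]
    exact Subgroup.pointwise_smul_le_pointwise_smul_iff.1 h2
  set F := fusionOf S K hSK with hF
  let α : E →* MulAut (P.subgroupOf S) :=
    (MulAut.congr (Subgroup.subgroupOfEquivOfLe hPS).symm).toMonoidHom.comp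
      (P.normalizerMonoidHom.comp (Subgroup.inclusion inf_le_left))
  have hα : ∀ (e : E) (x : P.subgroupOf S), ((α e x : S) : G) = e * ((x : S) : G) * (e : G)⁻¹ :=
    fun e x => rfl
  let β : E →* F.Aut (P.subgroupOf S) := α.codRestrict _ fun e => ⟨e, e.2.2, hα e⟩
  have hβ : Function.Surjective β := by
    rintro ⟨a, g, hg, ha⟩
    have hgN : conj g • P ≤ P := by
      refine conj_smul_le_iff.2 fun u hu => ?_
      have := ha ⟨⟨u, hPS hu⟩, hu⟩
      change _ = g * u * g⁻¹ at this
      rw [← this]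
      exact (a _).2
    refine ⟨⟨g, mem_normalizer_of_conj_smul_le hgN, hg⟩, Subtype.ext (MulEquiv.ext fun x => ?_)⟩
    exact Subtype.ext (Subtype.ext ((hα _ x).trans (ha x).symm))
  let ρ : E →* F.Out (P.subgroupOf S) := (QuotientGroup.mk' _).comp β
  have hρ : Function.Surjective ρ := (QuotientGroup.mk'_surjective _).comp hβ
  have hρ_iff : ∀ e : E, ρ e = 1 ↔ ∃ u ∈ P, u⁻¹ * (e : G) ∈ C := by
    intro e
    have h1 : ρ e = 1 ↔ α e ∈ innAut (P.subgroupOf S) := by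
      change (QuotientGroup.mk (β e) : F.Out (P.subgroupOf S)) = 1 ↔ _
      rw [QuotientGroup.eq_one_iff, Subgroup.mem_subgroupOf]
      rfl
    rw [h1]
    constructor
    · rintro ⟨u, hu⟩
      refine ⟨((u : S) : G), u.2, Subgroup.mem_centralizer_iff.2 fun x hx => ?_⟩
      have h2 : ((u : S) : G) * x * ((u : S) : G)⁻¹ = e * x * (e : G)⁻¹ :=
        congrArg (fun f : MulAut (P.subgroupOf S) => ((f ⟨⟨x, hPS hx⟩, hx⟩ : S) : G)) hu
      have h3 : x = ((u : S) : G)⁻¹ * (e * x * (e : G)⁻¹) * ((u : S) : G) := by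
        rw [← h2]
        group
      calc x * (((u : S) : G)⁻¹ * e)
          = ((u : S) : G)⁻¹ * (e * x * (e : G)⁻¹) * ((u : S) : G) * (((u : S) : G)⁻¹ * e) := by
            rw [← h3]
        _ = ((u : S) : G)⁻¹ * e * x := by group
    · rintro ⟨u, hu, huc⟩
      refine ⟨⟨⟨u, hPS hu⟩, hu⟩, MulEquiv.ext fun x => Subtype.ext (Subtype.ext ?_)⟩
      rw [hα]
      change u * ((x : S) : G) * u⁻¹ = _
      have h2 := Subgroup.mem_centralizer_iff.1 huc _ x.2
      have h3 : u * ((x : S) : G) * u⁻¹ = u * (((x : S) : G) * (u⁻¹ * e)) * (e : G)⁻¹ := by group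
      rw [h3]
      change u * (S.subtype x * (u⁻¹ * e)) * (e : G)⁻¹ = _
      rw [h2]
      change u * (u⁻¹ * e * ((x : S) : G)) * (e : G)⁻¹ = _
      group
  have hker : ∀ e : E, ρ e = 1 → (e : G) ∈ W ⊔ (E ⊓ C) := by
    intro e he
    obtain ⟨u, hu, huc⟩ := (hρ_iff e).1 he
    have huE : u⁻¹ * (e : G) ∈ E := E.mul_mem (E.inv_mem (hW.1 (hPW.le hu))) e.2
    have := (W ⊔ (E ⊓ C)).mul_mem (Subgroup.mem_sup_left (hPW.le hu))
      (Subgroup.mem_sup_right ⟨huE, huc⟩)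
    simpa using this
  have hWCM : W ⊔ (E ⊓ C) ≤ M := sup_le hWM hECM
  have hWCE : W ⊔ (E ⊓ C) ≤ E := sup_le hW.1 inf_le_left
  obtain ⟨T, hT⟩ := hW.exists_sylow
  refine ⟨(M.subgroupOf E).map ρ, fun htop => hnot fun e he => ?_, T.mapSurjective hρ, ?_, ?_, ?_⟩
  · have : ρ ⟨e, he⟩ ∈ (M.subgroupOf E).map ρ := by rw [htop]; trivial
    obtain ⟨m, hm, hme⟩ := this
    have h1 : ρ (m⁻¹ * ⟨e, he⟩) = 1 := by rw [map_mul, map_inv, hme, inv_mul_cancel]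
    have h2 := M.mul_mem hm (hWCM (hker _ h1))
    simpa using h2
  · rw [Sylow.coe_mapSurjective, hT]
    exact Subgroup.map_mono fun w hw => hWM hw
  · rw [Sylow.coe_mapSurjective, hT]
    intro hbot
    refine hPW.not_ge fun w hw => ?_
    have h1 : ρ ⟨w, hW.1 hw⟩ = 1 := by
      rw [← Subgroup.mem_bot, ← hbot]
      exact ⟨⟨w, hW.1 hw⟩, hw, rfl⟩
    obtain ⟨u, hu, huc⟩ := (hρ_iff _).1 h1
    have := P.mul_mem hu (hWC ⟨W.mul_mem (W.inv_mem (hPW.le hu)) hw, huc⟩)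
    simpa using this
  · intro h hh
    obtain ⟨e, rfl⟩ := hρ h
    have heM : (e : G) ∉ M := fun he => hh ⟨e, he, rfl⟩
    rw [Sylow.coe_mapSurjective, hT, eq_bot_iff]
    rintro z ⟨⟨_, ⟨w, hw, rfl⟩, hz⟩, w', hw', hz'⟩
    have hz : ρ e * ρ w * (ρ e)⁻¹ = z := hz
    rw [Subgroup.mem_bot]
    by_contra hz1
    have hwP : (w : G) ∉ P := by
      intro hwP
      apply hz1
      rw [← hz, (hρ_iff w).2 ⟨w, hwP, by simp [C.one_mem]⟩, mul_one, mul_inv_cancel]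
    have h1 : ρ (w'⁻¹ * (e * w * e⁻¹)) = 1 := by
      rw [map_mul, map_mul, map_mul, map_inv, map_inv, hz, hz', inv_mul_cancel]
    have h2 : (e : G) * w * (e : G)⁻¹ ∈ W ⊔ (E ⊓ C) := by
      have := (W ⊔ (E ⊓ C)).mul_mem (Subgroup.mem_sup_left hw') (hker _ h1)
      simpa using this
    have hQle : conj (e : G) • (Subgroup.zpowers (w : G) ⊔ P) ≤ W ⊔ (E ⊓ C) := by
      rw [Subgroup.smul_sup, hEP e e.2]
      refine sup_le ?_ (hPW.le.trans le_sup_left)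
      rw [conj_smul_le_iff_le_conj_inv_smul, Subgroup.zpowers_le, mem_conj_smul_iff, inv_inv]
      exact h2
    have hQW : Subgroup.zpowers (w : G) ⊔ P ≤ W := sup_le (Subgroup.zpowers_le.2 hw) hPW.le
    have : Finite (W ⊔ (E ⊓ C) : Subgroup G) := finite_of_le hWCE
    obtain ⟨f, hf, hfW⟩ := (hW.of_le hWCE le_sup_left).2.2 _ hQle
      ((hW.2.1.mono hQW).conj_smul _)
    rw [← conj_mul_smul] at hfW
    have hfe := hM _ (E.mul_mem (hWCE hf) e.2) _
      (lt_of_le_of_ne le_sup_right fun h => hwP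
        (h ▸ Subgroup.mem_sup_left (Subgroup.mem_zpowers (w : G)))) hQW hfW
    refine heM ?_
    simpa using M.mul_mem (M.inv_mem (hWCM hf)) hfe

theorem normalizer_inf_le_extendingSubgroup [Fact p.Prime] [Finite K] {P T W : Subgroup G}
    (hS : IsFinPSubgroup p S) (hSylK : IsSylowOf p S K)
    (hess : ∀ Q : Subgroup S, (fusionOf S K hSK).Essential p Q → IsPCentric p (Q.map S.subtype))
    (hP : ¬ IsPCentric p P) {x : G}
    (hW : IsSylowOf p W (Subgroup.normalizer (P : Set G) ⊓ conj x • K)) (hPW : P < W)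
    (hWT : W ≤ T) :
    Subgroup.normalizer (P : Set G) ⊓ conj x • K ≤ extendingSubgroup P T := by
  by_contra hnot
  have hWK : conj x⁻¹ • W ≤ K := by
    rw [← le_conj_smul_iff_conj_inv_smul_le]
    exact hW.1.trans inf_le_right
  obtain ⟨k, hk, hkS⟩ := hSylK.2.2 _ hWK (hW.2.1.conj_smul _)
  rw [← conj_mul_smul] at hkS
  set z := k * x⁻¹ with hz
  have hzK : conj z • conj x • K = K := by
    rw [hz, conj_mul_smul, conj_inv_smul_smul, Subgroup.conj_smul_eq_self_of_mem hk]
  have hzE : conj z • (Subgroup.normalizer (P : Set G) ⊓ conj x • K) =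
      Subgroup.normalizer ((conj z • P : Subgroup G) : Set G) ⊓ K := by
    rw [Subgroup.smul_inf, hzK, normalizer_conj_smul]
  have hmem : ∀ g, g ∈ Subgroup.normalizer ((conj z • P : Subgroup G) : Set G) ⊓ K →
      z⁻¹ * g * z ∈ Subgroup.normalizer (P : Set G) ⊓ conj x • K := fun g hg => by
    rwa [← hzE, mem_conj_smul_iff] at hg
  have hPz : conj z • P < conj z • W := (conj_smul_lt_conj_smul_iff z).2 hPW
  have key := essential_of_not_normalizer_le (hSK := hSK) (P := conj z • P) (W := conj z • W)
    (M := conj z • extendingSubgroup P T) hS ?_ hPz hkS ?_ ?_ ?_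
  · have h1 := hess _ key
    rw [Subgroup.map_subgroupOf_eq_of_le (hPz.le.trans hkS)] at h1
    have h2 := h1.conj_smul z⁻¹
    rw [conj_inv_smul_smul] at h2
    exact hP h2
  · refine ⟨?_, hW.2.1.conj_smul z, fun V hV hVp => ?_⟩
    · rw [← hzE]
      exact conj_smul_mono z hW.1
    · rw [← hzE, le_conj_smul_iff_conj_inv_smul_le] at hV
      obtain ⟨e, he, heW⟩ := hW.2.2 _ hV (hVp.conj_smul _)
      refine ⟨z * e * z⁻¹, ?_, ?_⟩
      · rw [← hzE, mem_conj_smul_iff]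
        simpa [mul_assoc] using he
      · rw [conj_mul_smul, conj_mul_smul]
        exact conj_smul_mono z heW
  · rw [centralizer_conj_smul]
    exact inf_le_left.trans (conj_smul_mono z (centralizer_le_extendingSubgroup P T))
  · intro g hg Q hPQ hQW hgQ
    rw [mem_conj_smul_iff]
    refine mem_extendingSubgroup (Q := conj z⁻¹ • Q) (hmem g hg).1 ?_ ?_ ?_
    · rwa [← conj_smul_lt_conj_smul_iff z, conj_smul_inv_smul]
    · rw [← le_conj_smul_iff_conj_inv_smul_le]
      exact hQW.trans (conj_smul_mono z hWT)
    · rw [← conj_mul_smul, mul_assoc (z⁻¹ * g), mul_inv_cancel, mul_one, conj_mul_smul,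
        ← le_conj_smul_iff_conj_inv_smul_le]
      exact hgQ.trans (conj_smul_mono z hWT)
  · rw [← hzE, Subgroup.pointwise_smul_le_pointwise_smul_iff]
    exact hnot

/-- If the `p`-centric subgroups have the Sylow property for centralizers, and essential subgroups
of the members of `𝒦` are `p`-centric, then all finite `p`-subgroups have it. -/
theorem hasCentralizerSylow_of_isPCentric [Fact p.Prime] {𝒦 : Set (Subgroup G)}
    (hS : IsFinPSubgroup p S)
    (hSyl : ∀ V : Subgroup G, IsFinPSubgroup p V → ∃ g : G, conj g • V ≤ S)
    (h𝒦 : ∀ K ∈ 𝒦, Finite K ∧ S ≤ K)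
    (hess : ∀ K ∈ 𝒦, ∀ (hSK : S ≤ K) (Q : Subgroup S),
      (fusionOf S K hSK).Essential p Q → IsPCentric p (Q.map S.subtype))
    (hchain : ∀ P : Subgroup G, IsFinPSubgroup p P → ∀ x y : G, P ≤ conj x • S → P ≤ conj y • S →
      Relation.ReflTransGen (GalleryStep S 𝒦 P) x y)
    (hcentric : ∀ P : Subgroup G, IsFinPSubgroup p P → IsPCentric p P → HasCentralizerSylow p P)
    (P : Subgroup G) (hP : IsFinPSubgroup p P) : HasCentralizerSylow p P := by
  have hm : ∀ V : Subgroup G, IsFinPSubgroup p V → Nat.card V ≤ Nat.card S := by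
    intro V hV
    obtain ⟨g, hg⟩ := hSyl V hV
    have := hS.1
    rw [← card_conj_smul g V]
    exact Subgroup.card_le_of_le hg
  induction hk : Nat.card S - Nat.card P using Nat.strong_induction_on generalizing P with
  | _ k ih =>
    by_cases hPc : IsPCentric p P
    · exact hcentric P hP hPc
    have hgood : ∀ R, P < R → IsFinPSubgroup p R → HasCentralizerSylow p R := by
      intro R hPR hR
      have h1 := hR.card_lt hPR
      have h2 := hm R hR
      exact ih _ (by omega) R hR rfl
    have hPS : ∀ x : G, ¬ conj x • S ≤ P := by
      intro x hx
      refine hPc fun V hV hVp => ?_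
      have hle := hm _ (hVp.sup hP (hV.trans (Subgroup.centralizer_le_normalizer _)))
      have hfin := (hVp.sup hP (hV.trans (Subgroup.centralizer_le_normalizer _))).1
      have hPfin := hP.1
      rw [← card_conj_smul x S] at hle
      have := Subgroup.eq_of_le_of_card_ge (le_sup_right : P ≤ V ⊔ P)
        (hle.trans (Subgroup.card_le_of_le hx))
      rw [this]
      exact le_sup_left
    obtain ⟨T, hT⟩ := exists_isSylowOf_normalizer hS hSyl h𝒦 hP hPS (hchain P hP) hgood
    have hPT : P ≤ T := by
      obtain ⟨n, hn, hnT⟩ := hT.2.2 P Subgroup.le_normalizer hP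
      rwa [mem_normalizer_iff_conj_smul_eq.1 hn] at hnT
    refine hasCentralizerSylow_of_normalizer_le hP hgood hT ?_ ?_
    · intro hle
      refine hPc fun V hV hVp => ?_
      obtain ⟨n, hn, hnT⟩ := hT.2.2 V (hV.trans (Subgroup.centralizer_le_normalizer _)) hVp
      have h1 : conj n • V ≤ conj n • P := by
        rw [mem_normalizer_iff_conj_smul_eq.1 hn]
        refine (le_inf hnT ?_).trans hle
        rw [← mem_normalizer_iff_conj_smul_eq.1 (normalizer_le_normalizer_centralizer P hn)]
        exact conj_smul_mono n hV
      exact Subgroup.pointwise_smul_le_pointwise_smul_iff.1 h1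
    · refine le_trans ?_ (extendingSubgroup_le hgood hT)
      refine normalizer_le_extendingSubgroup hS hSyl h𝒦 hPS (hchain P hP) hT hPT ?_
      intro K hK x W hW hPW hWT
      have := (h𝒦 K hK).1
      have hSylK : IsSylowOf p S K :=
        isSylowOf_of_card_le (h𝒦 K hK).2 hS.2 fun V _ hV => hm V hV
      exact normalizer_inf_le_extendingSubgroup (hSK := (h𝒦 K hK).2) hS hSylK
        (hess K hK (h𝒦 K hK).2) hPc hW hPW hWT

end FusionOf

section Saturation

variable {G : Type*} [Group G] {p : ℕ} {S K : Subgroup G} {hSK : S ≤ K}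

theorem exists_hom_top_of_conj_smul_le (P : Subgroup S) {g : G} (hg : g ∈ K)
    (h : conj g • P.map S.subtype ≤ S) :
    ∃ φ ∈ (fusionOf S K hSK).Hom P ⊤, ∀ x : P, ((φ x : S) : G) = g * ((x : S) : G) * g⁻¹ :=
  exists_hom_of_conj_smul_le P ⊤ hg (by rwa [← MonoidHom.range_eq_map, Subgroup.range_subtype])

theorem FusionSystem.FullyNormalized.card_le {P : Subgroup S}
    (hP : (fusionOf S K hSK).FullyNormalized P) {g : G} (hg : g ∈ K)
    (h : conj g • P.map S.subtype ≤ S) :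
    Nat.card (S ⊓ Subgroup.normalizer ((conj g • P.map S.subtype : Subgroup G) : Set G) :
      Subgroup G) ≤
    Nat.card (S ⊓ Subgroup.normalizer (P.map S.subtype : Set G) : Subgroup G) := by
  obtain ⟨φ, hφ, hφg⟩ := exists_hom_top_of_conj_smul_le (hSK := hSK) P hg h
  rw [← map_imageIn hφg, ← map_normalizer, ← map_normalizer, card_map_subtype, card_map_subtype]
  exact hP φ hφ

theorem fullyCentralized_fusionOf_iff {P : Subgroup S} :
    (fusionOf S K hSK).FullyCentralized P ↔ ∀ g ∈ K, conj g • P.map S.subtype ≤ S →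
      Nat.card (S ⊓ Subgroup.centralizer ((conj g • P.map S.subtype : Subgroup G) : Set G) :
        Subgroup G) ≤
      Nat.card (S ⊓ Subgroup.centralizer (P.map S.subtype : Set G) : Subgroup G) := by
  constructor
  · intro hP g hg h
    obtain ⟨φ, hφ, hφg⟩ := exists_hom_top_of_conj_smul_le (hSK := hSK) P hg h
    rw [← map_imageIn hφg, ← map_centralizer, ← map_centralizer, card_map_subtype,
      card_map_subtype]
    exact hP φ hφ
  · rintro h φ ⟨g, hg, hφ⟩
    have h1 := h g hg (by rw [← map_imageIn hφ]; exact Subgroup.map_subtype_le _)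
    rwa [← map_imageIn hφ, ← map_centralizer, ← map_centralizer, card_map_subtype,
      card_map_subtype] at h1

theorem pow_mem_of_mem_sup [Fact p.Prime] {U C : Subgroup G} (hU : IsFinPSubgroup p U)
    (hUC : U ≤ Subgroup.normalizer (C : Set G)) {x : G} (hx : x ∈ U ⊔ C) :
    ∃ k : ℕ, x ^ p ^ k ∈ C := by
  have hn : (C.subgroupOf (U ⊔ C)).Normal :=
    Subgroup.normal_subgroupOf_of_le_normalizer (sup_le hUC Subgroup.le_normalizer)
  obtain ⟨u, hu, c, hc, rfl⟩ := (mem_sup_iff_of_le_normalizer hUC).1 hx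
  obtain ⟨k, hk⟩ := isPGroup_iff_pow_pow_eq_one.1 hU.2 ⟨u, hu⟩
  have hk : u ^ p ^ k = 1 := congrArg Subtype.val hk
  refine ⟨k, ?_⟩
  have h1 : (QuotientGroup.mk (⟨u * c, hx⟩ : (U ⊔ C : Subgroup G)) :
      _ ⧸ C.subgroupOf (U ⊔ C)) = QuotientGroup.mk ⟨u, Subgroup.mem_sup_left hu⟩ := by
    rw [eq_comm, QuotientGroup.eq]
    simpa [Subgroup.mem_subgroupOf] using hc
  have h2 := congrArg (fun y => y ^ p ^ k) h1
  have h3 : (⟨u, Subgroup.mem_sup_left hu⟩ : (U ⊔ C : Subgroup G)) ^ p ^ k = 1 :=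
    Subtype.ext hk
  simp only [← QuotientGroup.mk_pow, h3, QuotientGroup.mk_one] at h2
  rw [QuotientGroup.eq_one_iff] at h2
  exact h2

theorem isSylowOf_of_fullyNormalized [Fact p.Prime] (hS : IsFinPSubgroup p S)
    (hSyl : ∀ V : Subgroup G, IsFinPSubgroup p V → ∃ g : G, conj g • V ≤ S)
    {P : Subgroup S} (hP : (fusionOf S ⊤ le_top).FullyNormalized P)
    (hgood : HasCentralizerSylow p (P.map S.subtype)) :
    IsSylowOf p (S ⊓ Subgroup.normalizer (P.map S.subtype : Set G))
      (Subgroup.normalizer (P.map S.subtype : Set G)) := by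
  have hPp : IsFinPSubgroup p (P.map S.subtype) := hS.mono (Subgroup.map_subtype_le P)
  have hFN := fun {g : G} => hP.card_le (g := g) (Subgroup.mem_top g)
  generalize P.map S.subtype = P' at *
  have := hPp.1
  obtain ⟨V, hV, -⟩ := exists_isSylowOf_of_hasCentralizerSylow hgood
    (Subgroup.centralizer_le_normalizer _) le_rfl
  have hPV : P' ≤ V := by
    obtain ⟨n, hn, hnV⟩ := hV.2.2 P' Subgroup.le_normalizer hPp
    rwa [mem_normalizer_iff_conj_smul_eq.1 hn] at hnV
  obtain ⟨g, hg⟩ := hSyl V hV.2.1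
  have hUp : IsFinPSubgroup p (S ⊓ Subgroup.normalizer (P' : Set G)) := hS.mono inf_le_left
  have hcard : Nat.card V ≤ Nat.card (S ⊓ Subgroup.normalizer (P' : Set G) : Subgroup G) := by
    refine le_trans ?_ (hFN ((conj_smul_mono g hPV).trans hg))
    have := (hS.mono (inf_le_left : S ⊓
      Subgroup.normalizer ((conj g • P' : Subgroup G) : Set G) ≤ S)).1
    rw [← card_conj_smul g V]
    refine Subgroup.card_le_of_le (le_inf hg ?_)
    rw [normalizer_conj_smul]
    exact conj_smul_mono g hV.1
  refine ⟨inf_le_right, hUp, fun V' hV' hV'p => ?_⟩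
  obtain ⟨n, hn, hnV⟩ := hV.2.2 _ inf_le_right hUp
  have := hV.2.1.1
  have heq := Subgroup.eq_of_le_of_card_ge hnV (by rwa [card_conj_smul])
  obtain ⟨m, hm, hmV⟩ := hV.2.2 V' hV' hV'p
  refine ⟨n⁻¹ * m, Subgroup.mul_mem _ (Subgroup.inv_mem _ hn) hm, ?_⟩
  rw [conj_mul_smul, ← le_conj_smul_iff_conj_inv_smul_le, heq]
  exact hmV

theorem IsSylowOf.le_sup_centralizer {P U L : Subgroup G}
    (hgood : HasCentralizerSylow p P)
    (hU : IsSylowOf p U (Subgroup.normalizer (P : Set G)))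
    (hCL : Subgroup.centralizer (P : Set G) ≤ L) (hLN : L ≤ Subgroup.normalizer (P : Set G))
    (hL : ∀ x ∈ L, ∃ k : ℕ, x ^ p ^ k ∈ Subgroup.centralizer (P : Set G)) (hUL : U ≤ L) :
    L ≤ U ⊔ Subgroup.centralizer (P : Set G) ∧ ∀ V ≤ L, IsFinPSubgroup p V →
      ∃ c ∈ Subgroup.centralizer (P : Set G), conj c • V ≤ U := by
  obtain ⟨V, hVL, hVp, hLV, hconj⟩ := hgood L hCL hLN hL
  obtain ⟨c, hc, hcV⟩ := hconj U hUL hU.2.1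
  have := hVp.1
  have heq : conj c • U = V := Subgroup.eq_of_le_of_card_ge hcV
    (by rw [card_conj_smul]; exact hU.card_le (hVL.trans hLN) hVp)
  constructor
  · have h1 := conj_smul_mono c⁻¹ hLV
    rwa [Subgroup.smul_sup, ← heq, conj_inv_smul_smul,
      Subgroup.conj_smul_eq_self_of_mem (Subgroup.inv_mem _ hc),
      Subgroup.conj_smul_eq_self_of_mem (Subgroup.inv_mem _ (hCL hc))] at h1
  · intro V' hV' hV'p
    obtain ⟨d, hd, hdV⟩ := hconj V' hV' hV'p
    refine ⟨c⁻¹ * d, Subgroup.mul_mem _ (Subgroup.inv_mem _ hc) hd, ?_⟩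
    rwa [conj_mul_smul, ← le_conj_smul_iff_conj_inv_smul_le, heq]

theorem exists_conj_smul_le_of_card_centralizer_le [Fact p.Prime] {P : Subgroup G}
    (hS : IsFinPSubgroup p S) (hgood : HasCentralizerSylow p P)
    (hcard : ∀ V ≤ Subgroup.centralizer (P : Set G), IsFinPSubgroup p V →
      Nat.card V ≤ Nat.card (S ⊓ Subgroup.centralizer (P : Set G) : Subgroup G))
    {V' : Subgroup G}
    (hV' : V' ≤ (S ⊓ Subgroup.normalizer (P : Set G)) ⊔ Subgroup.centralizer (P : Set G))
    (hV'p : IsFinPSubgroup p V') :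
    ∃ c ∈ Subgroup.centralizer (P : Set G), conj c • V' ≤ S := by
  set N := Subgroup.normalizer (P : Set G) with hN
  set C := Subgroup.centralizer (P : Set G) with hC
  have hUp : IsFinPSubgroup p (S ⊓ N) := hS.mono inf_le_left
  have hUC : S ⊓ N ≤ Subgroup.normalizer (C : Set G) :=
    inf_le_right.trans (normalizer_le_normalizer_centralizer P)
  obtain ⟨V, hVL, hVp, -, hconj⟩ := hgood (S ⊓ N ⊔ C) le_sup_right
    (sup_le inf_le_right (Subgroup.centralizer_le_normalizer _))
    (fun x hx => pow_mem_of_mem_sup hUp hUC hx)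
  obtain ⟨c, hc, hcV⟩ := hconj _ le_sup_left hUp
  have hSCV : conj c • (S ⊓ C) = V ⊓ C := by
    have := (hVp.mono (inf_le_left : V ⊓ C ≤ V)).1
    refine Subgroup.eq_of_le_of_card_ge (le_inf ?_ ?_) ?_
    · exact (conj_smul_mono c
        (inf_le_inf_left S (Subgroup.centralizer_le_normalizer _))).trans hcV
    · exact conj_smul_le_of_le_of_mem inf_le_right hc
    · rw [card_conj_smul]
      exact hcard _ inf_le_right (hVp.mono inf_le_left)
  have hVU : V ≤ conj c • (S ⊓ N) := by
    intro v hv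
    have h1 : v ∈ conj c • (S ⊓ N ⊔ C) := by
      rw [Subgroup.conj_smul_eq_self_of_mem (Subgroup.mem_sup_right hc)]
      exact hVL hv
    rw [mem_conj_smul_iff, mem_sup_iff_of_le_normalizer hUC] at h1
    obtain ⟨u, hu, d, hd, hud⟩ := h1
    have h2 : c * u * c⁻¹ ∈ V := conj_smul_le_iff.1 hcV u hu
    have h3 : v = c * u * c⁻¹ * (c * d * c⁻¹) := by
      have : v = c * (c⁻¹ * v * c) * c⁻¹ := by group
      rw [this, ← hud]
      group
    have h4 : c * d * c⁻¹ ∈ V ⊓ C := by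
      refine ⟨?_, C.mul_mem (C.mul_mem hc hd) (C.inv_mem hc)⟩
      have := V.mul_mem (V.inv_mem h2) hv
      rwa [h3, inv_mul_cancel_left] at this
    rw [← hSCV] at h4
    rw [h3]
    refine Subgroup.mul_mem _ (mem_conj_smul_iff.2 (by simpa [mul_assoc] using hu))
      (conj_smul_mono c (inf_le_inf_left S (Subgroup.centralizer_le_normalizer _)) h4)
  obtain ⟨d, hd, hdV⟩ := hconj V' hV' hV'p
  refine ⟨c⁻¹ * d, C.mul_mem (C.inv_mem hc) hd, ?_⟩
  rw [conj_mul_smul, ← le_conj_smul_iff_conj_inv_smul_le]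
  exact hdV.trans (hVU.trans (conj_smul_mono c inf_le_left))

theorem fullyCentralized_of_fullyNormalized [Fact p.Prime] (hS : IsFinPSubgroup p S)
    (hSyl : ∀ V : Subgroup G, IsFinPSubgroup p V → ∃ g : G, conj g • V ≤ S)
    (hgood : ∀ P : Subgroup G, IsFinPSubgroup p P → HasCentralizerSylow p P)
    {P : Subgroup S} (hP : (fusionOf S ⊤ le_top).FullyNormalized P) :
    (fusionOf S ⊤ le_top).FullyCentralized P := by
  have hPp : IsFinPSubgroup p (P.map S.subtype) := hS.mono (Subgroup.map_subtype_le P)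
  have hU := isSylowOf_of_fullyNormalized hS hSyl hP (hgood _ hPp)
  rw [fullyCentralized_fusionOf_iff]
  intro g _ _
  generalize P.map S.subtype = P' at *
  set C := Subgroup.centralizer (P' : Set G) with hC
  obtain ⟨c, hc, hcU⟩ := (hU.le_sup_centralizer (hgood P' hPp) le_sup_right
    (sup_le hU.1 (Subgroup.centralizer_le_normalizer _))
    (fun x hx => pow_mem_of_mem_sup hU.2.1
      (hU.1.trans (normalizer_le_normalizer_centralizer P')) hx) le_sup_left).2
    (conj g⁻¹ • (S ⊓ Subgroup.centralizer ((conj g • P' : Subgroup G) : Set G)))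
    (by
      refine le_trans ?_ le_sup_right
      rw [centralizer_conj_smul, ← le_conj_smul_iff_conj_inv_smul_le]
      exact inf_le_right)
    ((hS.mono inf_le_left).conj_smul _)
  have := (hS.mono (inf_le_left : S ⊓ C ≤ S)).1
  rw [← card_conj_smul g⁻¹, ← card_conj_smul c]
  refine Subgroup.card_le_of_le (le_inf (hcU.trans inf_le_left) ?_)
  refine conj_smul_le_of_le_of_mem ?_ hc
  rw [centralizer_conj_smul, ← le_conj_smul_iff_conj_inv_smul_le]
  exact inf_le_right

theorem exists_sylow_autSelf_of_fullyNormalized [Fact p.Prime] (hS : IsFinPSubgroup p S)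
    (hSyl : ∀ V : Subgroup G, IsFinPSubgroup p V → ∃ g : G, conj g • V ≤ S)
    (hgood : ∀ P : Subgroup G, IsFinPSubgroup p P → HasCentralizerSylow p P)
    {P : Subgroup S} (hP : (fusionOf S ⊤ le_top).FullyNormalized P) :
    ∃ T : Sylow p ((fusionOf S ⊤ le_top).Aut P),
      (T : Subgroup ((fusionOf S ⊤ le_top).Aut P)) =
        (autSelf P).subgroupOf ((fusionOf S ⊤ le_top).Aut P) := by
  set F := fusionOf S ⊤ le_top with hF
  have hPp : IsFinPSubgroup p (P.map S.subtype) := hS.mono (Subgroup.map_subtype_le P)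
  have hU := isSylowOf_of_fullyNormalized hS hSyl hP (hgood _ hPp)
  set P' := P.map S.subtype with hP'
  set N := Subgroup.normalizer (P' : Set G) with hN
  set C := Subgroup.centralizer (P' : Set G) with hC
  let α : N →* MulAut P :=
    (MulAut.congr
      (Subgroup.equivMapOfInjective P S.subtype S.subtype_injective).symm).toMonoidHom.comp
        P'.normalizerMonoidHom
  have hα : ∀ (n : N) (x : P), ((α n x : S) : G) = n * ((x : S) : G) * (n : G)⁻¹ := by
    intro n x
    set ε := Subgroup.equivMapOfInjective P S.subtype S.subtype_injective with hε
    have h1 : ∀ y : P', ((ε.symm y : S) : G) = y := by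
      intro y
      obtain ⟨z, rfl⟩ := ε.surjective y
      rw [MulEquiv.symm_apply_apply]
      rfl
    exact h1 _
  have hα_inj : ∀ n m : N, α n = α m → (m : G)⁻¹ * n ∈ C := by
    intro n m h
    refine Subgroup.mem_centralizer_iff.2 ?_
    rintro _ ⟨x, hx, rfl⟩
    have h1 := hα n ⟨x, hx⟩
    rw [h, hα m] at h1
    change (m : G) * (x : G) * (m : G)⁻¹ = n * (x : G) * (n : G)⁻¹ at h1
    change (x : G) * _ = _ * (x : G)
    have h2 : (x : G) = (m : G)⁻¹ * (m * x * (m : G)⁻¹) * m := by group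
    rw [h1] at h2
    calc (x : G) * ((m : G)⁻¹ * n) = (m : G)⁻¹ * (n * x * (n : G)⁻¹) * m * ((m : G)⁻¹ * n) := by
          rw [← h2]
      _ = _ := by group
  have hα_eq : ∀ n m : N, (m : G)⁻¹ * n ∈ C → α n = α m := by
    intro n m h
    refine MulEquiv.ext fun x => Subtype.ext (Subtype.ext ?_)
    rw [hα, hα]
    have h1 := Subgroup.mem_centralizer_iff.1 h _ (Subgroup.mem_map_of_mem S.subtype x.2)
    change ((x : S) : G) * _ = _ * ((x : S) : G) at h1
    calc (n : G) * ((x : S) : G) * (n : G)⁻¹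
        = m * ((m : G)⁻¹ * n * ((x : S) : G)) * (n : G)⁻¹ := by group
      _ = m * ((x : S) : G) * (m : G)⁻¹ := by rw [← h1]; group
  have hα_surj : ∀ a ∈ F.Aut P, ∃ n : N, α n = a := by
    rintro a ⟨g, -, ha⟩
    have := hPp.1
    have hgN : conj g • P' ≤ P' := by
      rw [conj_smul_le_iff]
      rintro _ ⟨x, hx, rfl⟩
      have := ha ⟨x, hx⟩
      change _ = g * S.subtype x * g⁻¹ at this
      rw [← this]
      exact Subgroup.mem_map_of_mem S.subtype (a ⟨x, hx⟩).2
    refine ⟨⟨g, mem_normalizer_of_conj_smul_le hgN⟩, MulEquiv.ext fun x => ?_⟩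
    exact Subtype.ext (Subtype.ext ((hα _ x).trans (ha x).symm))
  have hself : ∀ n : N, (n : G) ∈ S → α n ∈ autSelf P := by
    intro n hn
    have h1 : (n : G) ∈ (Subgroup.normalizer (P : Set S)).map S.subtype := by
      rw [map_normalizer]
      exact ⟨hn, n.2⟩
    obtain ⟨s, hs, hsn⟩ := h1
    refine ⟨⟨s, hs⟩, MulEquiv.ext fun x => Subtype.ext (Subtype.ext ?_)⟩
    rw [hα, ← hsn]
    rfl
  have hSp : IsPGroup p (autSelf P) :=
    (hS.2.to_subgroup (Subgroup.normalizer (P : Set S))).of_surjective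
      P.normalizerMonoidHom.rangeRestrict P.normalizerMonoidHom.rangeRestrict_surjective
  refine ⟨⟨_, hSp.comap_subtype, fun {R} hR hle => le_antisymm ?_ hle⟩, rfl⟩
  set L : Subgroup G := ((R.map (F.Aut P).subtype).comap α).map N.subtype with hL
  have hLmem : ∀ n : N, (n : G) ∈ L ↔ α n ∈ R.map (F.Aut P).subtype := fun n =>
    Subgroup.mem_map_iff_mem N.subtype_injective
  have hLN : L ≤ N := Subgroup.map_subtype_le _
  have hCL : C ≤ L := by
    intro c hc
    have h1 := (hLmem ⟨c, Subgroup.centralizer_le_normalizer _ hc⟩).2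
    refine h1 ?_
    rw [hα_eq _ 1 (by simpa using hc), map_one]
    exact one_mem _
  have hLp : ∀ x ∈ L, ∃ k : ℕ, x ^ p ^ k ∈ C := by
    intro x hx
    obtain ⟨r, hr, hrx⟩ := (hLmem ⟨x, hLN hx⟩).1 hx
    obtain ⟨k, hk⟩ := isPGroup_iff_pow_pow_eq_one.1 hR ⟨r, hr⟩
    have hk : r ^ p ^ k = 1 := congrArg Subtype.val hk
    refine ⟨k, ?_⟩
    have h1 : α (⟨x, hLN hx⟩ ^ p ^ k) = α 1 := by
      rw [map_pow, ← hrx, ← map_pow, hk, map_one, map_one]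
    simpa using hα_inj _ _ h1
  have hUL : S ⊓ N ≤ L := by
    intro u hu
    refine (hLmem ⟨u, hu.2⟩).2 ?_
    have h1 := hself ⟨u, hu.2⟩ hu.1
    have h2 : α ⟨u, hu.2⟩ ∈ F.Aut P := ⟨u, trivial, hα _⟩
    exact ⟨⟨_, h2⟩, hle h1, rfl⟩
  have hLU := (hU.le_sup_centralizer (hgood P' hPp) hCL hLN hLp hUL).1
  intro a ha
  obtain ⟨n, hn⟩ := hα_surj a a.2
  have hnL : (n : G) ∈ L := (hLmem n).2 ⟨a, ha, hn.symm⟩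
  obtain ⟨u, hu, c, hc, huc⟩ := (mem_sup_iff_of_le_normalizer
    (hU.1.trans (normalizer_le_normalizer_centralizer P'))).1 (hLU hnL)
  change (a : MulAut P) ∈ autSelf P
  rw [← hn, hα_eq n ⟨u, hu.2⟩ (by rw [← huc]; simpa using hc)]
  exact hself _ hu.1

theorem exists_extension_of_fullyCentralized [Fact p.Prime] (hS : IsFinPSubgroup p S)
    (hSyl : ∀ V : Subgroup G, IsFinPSubgroup p V → ∃ g : G, conj g • V ≤ S)
    (hgood : ∀ P : Subgroup G, IsFinPSubgroup p P → HasCentralizerSylow p P)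
    {P : Subgroup S} {φ : P →* (⊤ : Subgroup S)} (hφ : φ ∈ (fusionOf S ⊤ le_top).Hom P ⊤)
    (hc : (fusionOf S ⊤ le_top).FullyCentralized (imageIn φ)) :
    ∃ ψ ∈ (fusionOf S ⊤ le_top).Hom (extender φ) ⊤,
      ψ.comp (Subgroup.inclusion (le_extender φ)) = φ := by
  obtain ⟨g, -, hg⟩ := hφ
  have hQp : IsFinPSubgroup p ((imageIn φ).map S.subtype) := hS.mono (Subgroup.map_subtype_le _)
  rw [fullyCentralized_fusionOf_iff] at hc
  have hcard : ∀ V ≤ Subgroup.centralizer ((imageIn φ).map S.subtype : Set G),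
      IsFinPSubgroup p V → Nat.card V ≤
        Nat.card (S ⊓ Subgroup.centralizer ((imageIn φ).map S.subtype : Set G) : Subgroup G) := by
    intro V hV hVp
    obtain ⟨h, hh⟩ := hSyl _ (hVp.sup hQp (hV.trans (Subgroup.centralizer_le_normalizer _)))
    rw [Subgroup.smul_sup, sup_le_iff] at hh
    refine le_trans ?_ (hc h trivial hh.2)
    have := (hS.mono (inf_le_left : S ⊓ Subgroup.centralizer
      ((conj h • (imageIn φ).map S.subtype : Subgroup G) : Set G) ≤ S)).1
    rw [← card_conj_smul h V]
    refine Subgroup.card_le_of_le (le_inf hh.1 ?_)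
    rw [centralizer_conj_smul]
    exact conj_smul_mono h hV
  obtain ⟨c, hcC, hcS⟩ := exists_conj_smul_le_of_card_centralizer_le hS (hgood _ hQp) hcard
    (V' := conj g • (extender φ).map S.subtype)
    (by
      rw [conj_smul_le_iff]
      rintro _ ⟨x, ⟨hx, y, hy, hxy⟩, rfl⟩
      have hyN : S.subtype y ∈
          S ⊓ Subgroup.normalizer ((imageIn φ).map S.subtype : Set G) := by
        rw [← map_normalizer]
        exact Subgroup.mem_map_of_mem _ hy
      have hC : (S.subtype y)⁻¹ * (g * S.subtype x * g⁻¹) ∈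
          Subgroup.centralizer ((imageIn φ).map S.subtype : Set G) := by
        refine Subgroup.mem_centralizer_iff.2 ?_
        rintro _ ⟨_, ⟨u, rfl⟩, rfl⟩
        change ((φ u : S) : G) * _ = _ * ((φ u : S) : G)
        have h1 : ((φ (P.normalizerMonoidHom ⟨x, hx⟩ u) : S) : G) =
            S.subtype y * ((φ u : S) : G) * (S.subtype y)⁻¹ := congrArg Subtype.val (hxy u)
        rw [hg] at h1
        have h2 : (((P.normalizerMonoidHom ⟨x, hx⟩ u : P) : S) : G) =
            S.subtype x * ((u : S) : G) * (S.subtype x)⁻¹ := rfl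
        rw [h2] at h1
        have h3 := hg u
        have h4 : ((φ u : S) : G) = (S.subtype y)⁻¹ *
            (S.subtype y * ((φ u : S) : G) * (S.subtype y)⁻¹) * S.subtype y := by group
        rw [← h1] at h4
        calc ((φ u : S) : G) * ((S.subtype y)⁻¹ * (g * S.subtype x * g⁻¹))
            = (S.subtype y)⁻¹ * (g * (S.subtype x * ((u : S) : G) * (S.subtype x)⁻¹) * g⁻¹) *
                S.subtype y * ((S.subtype y)⁻¹ * (g * S.subtype x * g⁻¹)) := by rw [← h4]
          _ = (S.subtype y)⁻¹ * (g * S.subtype x * g⁻¹) * (g * ((u : S) : G) * g⁻¹) := by group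
          _ = _ := by rw [← h3]
      have := Subgroup.mul_mem_sup hyN hC
      rwa [mul_inv_cancel_left] at this)
    ((hS.mono (Subgroup.map_subtype_le _)).conj_smul g)
  rw [← conj_mul_smul] at hcS
  obtain ⟨ψ, hψ, hψg⟩ := exists_hom_top_of_conj_smul_le (hSK := le_top) _
    (Subgroup.mem_top (c * g)) hcS
  refine ⟨ψ, hψ, MonoidHom.ext fun u => Subtype.ext (Subtype.ext ?_)⟩
  rw [MonoidHom.comp_apply, hψg]
  change c * g * ((u : S) : G) * (c * g)⁻¹ = _
  have h1 := Subgroup.mem_centralizer_iff.1 hcC _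
    (Subgroup.mem_map_of_mem S.subtype (⟨u, rfl⟩ : ((φ u : S)) ∈ imageIn φ))
  change ((φ u : S) : G) * c = c * ((φ u : S) : G) at h1
  have h3 := hg u
  calc c * g * ((u : S) : G) * (c * g)⁻¹ = c * (g * ((u : S) : G) * g⁻¹) * c⁻¹ := by group
    _ = ((φ u : S) : G) := by rw [← h3, ← h1]; group

theorem saturated_of_hasCentralizerSylow [Fact p.Prime] (hS : IsFinPSubgroup p S)
    (hSyl : ∀ V : Subgroup G, IsFinPSubgroup p V → ∃ g : G, conj g • V ≤ S)
    (hgood : ∀ P : Subgroup G, IsFinPSubgroup p P → HasCentralizerSylow p P) :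
    (fusionOf S ⊤ le_top).Saturated p where
  finite := hS.1
  isPGroup := hS.2
  fullyCentralized _ hP := fullyCentralized_of_fullyNormalized hS hSyl hgood hP
  sylow _ hP := exists_sylow_autSelf_of_fullyNormalized hS hSyl hgood hP
  extends_to _ _ hφ hc := exists_extension_of_fullyCentralized hS hSyl hgood hφ hc

end Saturation

section CentricSubgroups

variable {G : Type*} [Group G] {p : ℕ}

/-- `T` is a finite `p`-subgroup of `L` with `L = T C_G(P)` and `P ∩ C_G(P) ≤ T`. -/
def IsFullIn (p : ℕ) (P L T : Subgroup G) : Prop :=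
  T ≤ L ∧ IsFinPSubgroup p T ∧ L ≤ T ⊔ Subgroup.centralizer (P : Set G) ∧
    P ⊓ Subgroup.centralizer (P : Set G) ≤ T

theorem IsFullIn.conj_smul {P L T : Subgroup G} (hT : IsFullIn p P L T)
    (hCL : Subgroup.centralizer (P : Set G) ≤ L)
    {c : G} (hc : c ∈ Subgroup.centralizer (P : Set G)) : IsFullIn p P L (conj c • T) := by
  refine ⟨conj_smul_le_of_le_of_mem hT.1 (hCL hc), hT.2.1.conj_smul c, ?_, ?_⟩
  · have := conj_smul_mono c hT.2.2.1
    rwa [Subgroup.smul_sup, Subgroup.conj_smul_eq_self_of_mem hc,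
      Subgroup.conj_smul_eq_self_of_mem (hCL hc)] at this
  · have := conj_smul_mono c hT.2.2.2
    rwa [Subgroup.smul_inf, Subgroup.conj_smul_eq_self_of_mem hc,
      mem_normalizer_iff_conj_smul_eq.1 (Subgroup.centralizer_le_normalizer _ hc)] at this

theorem IsFullIn.isSylowOf [Fact p.Prime] {P L T E : Subgroup G} (hPc : IsPCentric p P)
    (hLN : L ≤ Subgroup.normalizer (P : Set G)) (hT : IsFullIn p P L T) [Finite E]
    (hTE : T ≤ E) : IsSylowOf p T (E ⊓ L) := by
  have : Finite (E ⊓ L : Subgroup G) := finite_of_le inf_le_left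
  obtain ⟨W, hW, hTW⟩ := exists_isSylowOf_ge (le_inf hTE hT.1) hT.2.1.2
  have hWT : W ≤ T := by
    intro w hw
    obtain ⟨t, ht, c, hc, rfl⟩ := (mem_sup_iff_of_le_normalizer
      (hT.1.trans (hLN.trans (normalizer_le_normalizer_centralizer P)))).1
      (hT.2.2.1 (hW.1 hw).2)
    have hcW : c ∈ W := by simpa using W.mul_mem (W.inv_mem (hTW ht)) hw
    have hcP : W ⊓ Subgroup.centralizer (P : Set G) ≤ P :=
      hPc _ inf_le_right (hW.2.1.mono inf_le_left)
    exact T.mul_mem ht (hT.2.2.2 ⟨hcP ⟨hcW, hc⟩, hc⟩)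
  rwa [le_antisymm hTW hWT]

theorem IsFullIn.exists_conj_smul_eq [Fact p.Prime] {P L T T' E : Subgroup G}
    (hPc : IsPCentric p P) (hLN : L ≤ Subgroup.normalizer (P : Set G)) (hT : IsFullIn p P L T)
    (hT' : IsFullIn p P L T') [Finite E] (hTE : T ≤ E) (hTE' : T' ≤ E) :
    ∃ c ∈ Subgroup.centralizer (P : Set G), conj c • T' = T := by
  have h := hT.isSylowOf hPc hLN hTE
  have h' := hT'.isSylowOf hPc hLN hTE'
  obtain ⟨e, he, heT⟩ := h.2.2 T' h'.1 hT'.2.1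
  obtain ⟨t, ht, c, hc, rfl⟩ := (mem_sup_iff_of_le_normalizer
    (hT.1.trans (hLN.trans (normalizer_le_normalizer_centralizer P)))).1 (hT.2.2.1 he.2)
  have := hT.2.1.1
  refine ⟨c, hc, Subgroup.eq_of_le_of_card_ge ?_ ?_⟩
  · have h1 := conj_smul_le_of_le_of_mem heT (T.inv_mem ht)
    rwa [conj_mul_smul, conj_inv_smul_smul] at h1
  · rw [card_conj_smul]
    exact h'.card_le h.1 hT.2.1

theorem exists_isFullIn [Fact p.Prime] {P L E V : Subgroup G} [Finite E]
    (hP : IsFinPSubgroup p P)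
    (hCL : Subgroup.centralizer (P : Set G) ≤ L) (hLN : L ≤ Subgroup.normalizer (P : Set G))
    (hL : ∀ x ∈ L, ∃ k : ℕ, x ^ p ^ k ∈ Subgroup.centralizer (P : Set G)) (hPE : P ≤ E)
    (hfix : ∀ l ∈ L, ∃ c ∈ Subgroup.centralizer (P : Set G), c⁻¹ * l ∈ E)
    (hV : V ≤ E) (hVL : V ≤ L) (hVp : IsPGroup p V) :
    ∃ T, IsFullIn p P L T ∧ IsSylowOf p T (E ⊓ L) ∧ V ≤ T := by
  set C := Subgroup.centralizer (P : Set G) with hC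
  have hLC : L ≤ Subgroup.normalizer (C : Set G) :=
    hLN.trans (normalizer_le_normalizer_centralizer P)
  have : Finite (E ⊓ L : Subgroup G) := finite_of_le inf_le_left
  obtain ⟨T, hT, hVT⟩ := exists_isSylowOf_ge (le_inf hV hVL) hVp
  refine ⟨T, ⟨hT.1.trans inf_le_right, hT.2.1, ?_, ?_⟩, hT, hVT⟩
  · have h1 := hT.le_sup (inf_le_right.trans hLC) fun x hx => hL x hx.2
    intro l hl
    obtain ⟨c, hc, hcl⟩ := hfix l hl
    have h2 := (T ⊔ C).mul_mem (Subgroup.mem_sup_right hc)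
      (h1 ⟨hcl, L.mul_mem (L.inv_mem (hCL hc)) hl⟩)
    simpa using h2
  · obtain ⟨e, he, heT⟩ := hT.2.2 (P ⊓ C) (inf_le_inf hPE hCL) (hP.mono inf_le_left)
    rwa [Subgroup.smul_inf, mem_normalizer_iff_conj_smul_eq.1 (hLN he.2),
      mem_normalizer_iff_conj_smul_eq.1 (hLC he.2)] at heT

theorem mk_mem_fixedPoints_iff {P B : Subgroup G} {a : G} :
    (a : G ⧸ B) ∈ MulAction.fixedPoints P (G ⧸ B) ↔ P ≤ conj a • B := by
  rw [le_conj_smul_iff]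
  constructor
  · intro h q hq
    have h1 : ((q * a : G) : G ⧸ B) = a := h ⟨q, hq⟩
    rw [eq_comm, QuotientGroup.eq] at h1
    simpa [mul_assoc] using h1
  · intro h q
    change ((q * a : G) : G ⧸ B) = a
    rw [eq_comm, QuotientGroup.eq]
    simpa [mul_assoc] using h q q.2

/-- The `C_G(P)`-orbit of the `P`-fixed coset `aB`. -/
def orbitOf {P B : Subgroup G} (a : G) (ha : P ≤ conj a • B) : FixedOrbits P (G ⧸ B) :=
  Quotient.mk _ ⟨(a : G ⧸ B), mk_mem_fixedPoints_iff.2 ha⟩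

theorem exists_orbitOf_eq {P B : Subgroup G} (x : FixedOrbits P (G ⧸ B)) :
    ∃ (a : G) (ha : P ≤ conj a • B), orbitOf a ha = x := by
  obtain ⟨⟨c, hc⟩, rfl⟩ := Quotient.exists_rep x
  obtain ⟨a, rfl⟩ := QuotientGroup.mk_surjective c
  exact ⟨a, mk_mem_fixedPoints_iff.1 hc, rfl⟩

theorem exists_of_orbitOf_eq {P B : Subgroup G} {a b : G} {ha : P ≤ conj a • B}
    {hb : P ≤ conj b • B} (h : orbitOf a ha = orbitOf b hb) :
    ∃ c ∈ Subgroup.centralizer (P : Set G), (c * b)⁻¹ * a ∈ B := by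
  obtain ⟨c, hc⟩ := MulAction.orbitRel_apply.1 (Quotient.exact h)
  refine ⟨_, c.2, ?_⟩
  have h1 : ((((c : Subgroup.normalizer (P : Set G)) : G) * b : G) : G ⧸ B) = (a : G ⧸ B) :=
    congrArg Subtype.val hc
  exact QuotientGroup.eq.1 h1

theorem smul_orbitOf_eq_iff {P B : Subgroup G} {a : G} {ha : P ≤ conj a • B}
    (n : Subgroup.normalizer (P : Set G)) :
    (QuotientGroup.mk n : AutBy P) • orbitOf a ha = orbitOf a ha ↔
      ∃ c ∈ Subgroup.centralizer (P : Set G), c⁻¹ * (n : G) ∈ conj a • B := by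
  have h0 : (QuotientGroup.mk n : AutBy P) • orbitOf a ha =
      Quotient.mk _ (n • ⟨(a : G ⧸ B), mk_mem_fixedPoints_iff.2 ha⟩) := rfl
  rw [h0]
  constructor
  · intro h
    obtain ⟨c, hc⟩ := MulAction.orbitRel_apply.1 (Quotient.exact h)
    refine ⟨_, c.2, ?_⟩
    have h1 : ((((c : Subgroup.normalizer (P : Set G)) : G) * a : G) : G ⧸ B) =
        ((n * a : G) : G ⧸ B) := congrArg Subtype.val hc
    rw [QuotientGroup.eq] at h1
    rw [mem_conj_smul_iff]
    simpa [mul_assoc] using h1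
  · rintro ⟨c, hc, hca⟩
    refine Quotient.sound (MulAction.orbitRel_apply.2
      ⟨⟨⟨c, Subgroup.centralizer_le_normalizer _ hc⟩, hc⟩, Subtype.ext ?_⟩)
    change ((c * a : G) : G ⧸ B) = ((n * a : G) : G ⧸ B)
    rw [QuotientGroup.eq]
    rw [mem_conj_smul_iff] at hca
    simpa [mul_assoc] using hca

/-- The image of `L` in `Aut_G(P)`. -/
def autImage (P L : Subgroup G) : Subgroup (AutBy P) :=
  (L.subgroupOf (Subgroup.normalizer (P : Set G))).map (QuotientGroup.mk' (centInNorm P))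

theorem orbitOf_mem_fixedPoints_iff {P B L : Subgroup G} {a : G} {ha : P ≤ conj a • B}
    (hLN : L ≤ Subgroup.normalizer (P : Set G)) :
    orbitOf a ha ∈ MulAction.fixedPoints (autImage P L) (FixedOrbits P (G ⧸ B)) ↔
      ∀ l ∈ L, ∃ c ∈ Subgroup.centralizer (P : Set G), c⁻¹ * l ∈ conj a • B := by
  constructor
  · intro h l hl
    exact (smul_orbitOf_eq_iff ⟨l, hLN hl⟩).1 (h ⟨_, ⟨⟨l, hLN hl⟩, hl, rfl⟩⟩)
  · rintro h ⟨_, ⟨n, hn, rfl⟩⟩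
    exact (smul_orbitOf_eq_iff n).2 (h n hn)

theorem isPGroup_autImage {P L : Subgroup G}
    (hL : ∀ x ∈ L, ∃ k : ℕ, x ^ p ^ k ∈ Subgroup.centralizer (P : Set G)) :
    IsPGroup p (autImage P L) := by
  rw [isPGroup_iff_pow_pow_eq_one]
  rintro ⟨_, ⟨n, hn, rfl⟩⟩
  obtain ⟨k, hk⟩ := hL n hn
  refine ⟨k, Subtype.ext ?_⟩
  change (QuotientGroup.mk n : AutBy P) ^ p ^ k = 1
  rw [← QuotientGroup.mk_pow, QuotientGroup.eq_one_iff, Subgroup.mem_subgroupOf]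
  exact hk

/-- Along a gallery of `L`-fixed chambers of `C^P / C_G(P)`, the full subgroups of `L` in the
stabilizers of the chambers are conjugate under `C_G(P)`. -/
theorem IsFullIn.exists_conj_smul_eq_of_gallery [Fact p.Prime] {I : Type*} {B : Subgroup G}
    {K : I → Subgroup G} (hBK : ∀ i, B ≤ K i) [Finite B] (hK : ∀ i, Finite (K i))
    {P L : Subgroup G} (hP : IsFinPSubgroup p P) (hPc : IsPCentric p P)
    (hCL : Subgroup.centralizer (P : Set G) ≤ L) (hLN : L ≤ Subgroup.normalizer (P : Set G))
    (hL : ∀ x ∈ L, ∃ k : ℕ, x ^ p ^ k ∈ Subgroup.centralizer (P : Set G))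
    {a b : G} (ha : P ≤ conj a • B) {hb : P ≤ conj b • B}
    {hfa : orbitOf a ha ∈ MulAction.fixedPoints (autImage P L) (FixedOrbits P (G ⧸ B))}
    {z : MulAction.fixedPoints (autImage P L) (FixedOrbits P (G ⧸ B))}
    (hz : Relation.ReflTransGen (fun x y => ∃ i : I,
      ((((ChamberSystem.coset B K hBK).fixedOrbits
        (ChamberSystem.coset_preserved B K hBK) P).fixed (autImage P L)).adj i).r x y)
      ⟨_, hfa⟩ z) (hbz : orbitOf b hb = z.1)
    {T₀ T : Subgroup G} (hT₀ : IsFullIn p P L T₀) (hT₀a : T₀ ≤ conj a • B)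
    (hT : IsFullIn p P L T) (hTb : T ≤ conj b • B) :
    ∃ c ∈ Subgroup.centralizer (P : Set G), conj c • T = T₀ := by
  set C := Subgroup.centralizer (P : Set G) with hC
  have hfinB : ∀ a : G, Finite (conj a • B : Subgroup G) := fun a =>
    Finite.of_equiv _ (Subgroup.equivSMul (conj a) B).toEquiv
  induction hz generalizing b T with
  | refl =>
    obtain ⟨c, hc, hcb⟩ := exists_of_orbitOf_eq (hb := ha) hbz
    have hcT : conj c⁻¹ • T ≤ conj a • B := by
      rw [← le_conj_smul_iff_conj_inv_smul_le, ← conj_mul_smul, ← conj_smul_eq_of_inv_mul_mem hcb]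
      exact hTb
    obtain ⟨d, hd, h⟩ := hT₀.exists_conj_smul_eq hPc hLN (hT.conj_smul hCL (C.inv_mem hc))
      hT₀a hcT
    exact ⟨d * c⁻¹, C.mul_mem hd (C.inv_mem hc), by rw [conj_mul_smul, h]⟩
  | @tail y z _ hyz ih =>
    obtain ⟨i, ⟨u, hu⟩, ⟨v, hv⟩, huy, hvz, huv⟩ := hyz
    obtain ⟨u, rfl⟩ := QuotientGroup.mk_surjective u
    obtain ⟨v, rfl⟩ := QuotientGroup.mk_surjective v
    have hadj : u⁻¹ * v ∈ K i := QuotientGroup.eq.1 huv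
    have hPu := mk_mem_fixedPoints_iff.1 hu
    have hPv := mk_mem_fixedPoints_iff.1 hv
    have huy : orbitOf u hPu = y.1 := huy
    have hvz : orbitOf v hPv = z.1 := hvz
    obtain ⟨c, hc, hcb⟩ := exists_of_orbitOf_eq (hbz.trans hvz.symm)
    have hcT : conj c⁻¹ • T ≤ conj v • B := by
      rw [← le_conj_smul_iff_conj_inv_smul_le, ← conj_mul_smul, ← conj_smul_eq_of_inv_mul_mem hcb]
      exact hTb
    have hufix : ∀ l ∈ L, ∃ c ∈ C, c⁻¹ * l ∈ conj u • B :=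
      (orbitOf_mem_fixedPoints_iff (ha := hPu) hLN).1 (huy ▸ y.2)
    obtain ⟨T', hT', hsyl, -⟩ := exists_isFullIn (V := ⊥) hP hCL hLN hL hPu hufix bot_le bot_le
      IsPGroup.of_bot
    obtain ⟨d, hd, h⟩ := ih huy hT' (hsyl.1.trans inf_le_left)
    have := hK i
    have : Finite (conj u • K i : Subgroup G) :=
      Finite.of_equiv _ (Subgroup.equivSMul (conj u) (K i)).toEquiv
    obtain ⟨e, he, h'⟩ := hT'.exists_conj_smul_eq hPc hLN (hT.conj_smul hCL (C.inv_mem hc))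
      ((hsyl.1.trans inf_le_left).trans (conj_smul_mono u (hBK i)))
      (by
        rw [← conj_smul_eq_of_inv_mul_mem hadj]
        exact hcT.trans (conj_smul_mono v (hBK i)))
    refine ⟨d * (e * c⁻¹), C.mul_mem hd (C.mul_mem he (C.inv_mem hc)), ?_⟩
    rw [conj_mul_smul, conj_mul_smul, h', h]

/-- If the fixed subsystems of `p`-subgroups of `Aut_G(P)` on `C^P / C_G(P)` are connected and `P`
is `p`-centric, then `P` has the Sylow property for centralizers. -/
theorem hasCentralizerSylow_of_connected [Fact p.Prime] {I : Type*} {B : Subgroup G}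
    {K : I → Subgroup G} (hBK : ∀ i, B ≤ K i) [Finite B] (hK : ∀ i, Finite (K i))
    (hSyl : ∀ V : Subgroup G, IsFinPSubgroup p V → ∃ g : G, conj g • V ≤ B)
    {P : Subgroup G} (hP : IsFinPSubgroup p P) (hPc : IsPCentric p P)
    (hconn : ∀ R : Subgroup (AutBy P), IsPGroup p R →
      (((ChamberSystem.coset B K hBK).fixedOrbits
        (ChamberSystem.coset_preserved B K hBK) P).fixed R).Connected) :
    HasCentralizerSylow p P := by
  have hNC := normalizer_le_normalizer_centralizer P
  intro L hCL hLN hL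
  set C := Subgroup.centralizer (P : Set G) with hC
  have hfinB : ∀ a : G, Finite (conj a • B : Subgroup G) := fun a =>
    Finite.of_equiv _ (Subgroup.equivSMul (conj a) B).toEquiv
  obtain ⟨⟨x, hx⟩⟩ := (hconn _ (isPGroup_autImage hL)).1
  obtain ⟨a, ha, rfl⟩ := exists_orbitOf_eq x
  have hfix := (orbitOf_mem_fixedPoints_iff (ha := ha) hLN).1 hx
  obtain ⟨V, hV, hVsyl, -⟩ := exists_isFullIn (V := ⊥) hP hCL hLN hL ha hfix bot_le bot_le
    IsPGroup.of_bot
  refine ⟨V, hV.1, hV.2.1, hV.2.2.1, fun V' hV' hV'p => ?_⟩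
  have hV'C : V' ≤ Subgroup.normalizer (C : Set G) := hV'.trans (hLN.trans hNC)
  obtain ⟨g, hg⟩ := hSyl _ (hV'p.sup hP (hV'.trans hLN))
  rw [conj_smul_le_iff_le_conj_inv_smul, sup_le_iff] at hg
  obtain ⟨hV'g, hPg⟩ := hg
  have hL'L : V' ⊔ C ≤ L := sup_le hV' hCL
  have hL'N := hL'L.trans hLN
  have hL' : ∀ x ∈ V' ⊔ C, ∃ k : ℕ, x ^ p ^ k ∈ C := fun x hx => hL x (hL'L hx)
  have hfa : ∀ l ∈ V' ⊔ C, ∃ c ∈ C, c⁻¹ * l ∈ conj a • B := fun l hl => hfix l (hL'L hl)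
  have hfb : ∀ l ∈ V' ⊔ C, ∃ c ∈ C, c⁻¹ * l ∈ conj g⁻¹ • B := by
    intro l hl
    obtain ⟨c, hc, v, hv, rfl⟩ := (mem_sup_iff_of_le_normalizer' hV'C).1 hl
    exact ⟨c, hc, by rw [inv_mul_cancel_left]; exact hV'g hv⟩
  obtain ⟨T₀, hT₀, hT₀syl, -⟩ := exists_isFullIn (V := ⊥) hP le_sup_right hL'N hL' ha hfa bot_le
    bot_le IsPGroup.of_bot
  obtain ⟨T, hT, hTsyl, hV'T⟩ := exists_isFullIn hP le_sup_right hL'N hL' hPg hfb hV'g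
    le_sup_left hV'p.2
  obtain ⟨c, hc, hcT⟩ := IsFullIn.exists_conj_smul_eq_of_gallery (hb := hPg) hBK hK hP hPc
    le_sup_right hL'N
    hL' ha ((hconn _ (isPGroup_autImage hL')).2
      ⟨_, (orbitOf_mem_fixedPoints_iff (ha := ha) hL'N).2 hfa⟩
      ⟨_, (orbitOf_mem_fixedPoints_iff (ha := hPg) hL'N).2 hfb⟩) rfl hT₀
    (hT₀syl.1.trans inf_le_left) hT (hTsyl.1.trans inf_le_left)
  obtain ⟨e, he, heV⟩ := hVsyl.2.2 T₀ (hT₀syl.1.trans (inf_le_inf_left _ hL'L)) hT₀.2.1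
  obtain ⟨v, hv, d, hd, rfl⟩ := (mem_sup_iff_of_le_normalizer
    (hV.1.trans (hLN.trans hNC))).1 (hV.2.2.1 he.2)
  refine ⟨d * c, C.mul_mem hd hc, ?_⟩
  have h1 := conj_smul_le_of_le_of_mem heV (V.inv_mem hv)
  rw [conj_mul_smul, conj_inv_smul_smul] at h1
  rw [conj_mul_smul]
  refine (conj_smul_mono d ?_).trans h1
  rw [← hcT]
  exact conj_smul_mono c hV'T

end CentricSubgroups

section Completions

variable {G : Type*} [Group G] {p : ℕ}

/-- Galleries of `P`-fixed chambers, with representatives chosen such that `P` lies in the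
corresponding conjugates of the Sylow subgroup `S` of `B`. -/
theorem exists_galleryStep_of_reflTransGen {I : Type*} {B S P : Subgroup G} {K : I → Subgroup G}
    (hBK : ∀ i, B ≤ K i) (hS : IsSylowOf p S B) (hP : IsFinPSubgroup p P) {x : G}
    {hfx : (x : G ⧸ B) ∈ MulAction.fixedPoints P (G ⧸ B)}
    {z : MulAction.fixedPoints P (G ⧸ B)}
    (hz : Relation.ReflTransGen
      (fun c d => ∃ i : I, (((ChamberSystem.coset B K hBK).fixed P).adj i).r c d) ⟨_, hfx⟩ z) :
    ∃ y : G, (y : G ⧸ B) = z.1 ∧ Relation.ReflTransGen (GalleryStep S (Set.range K) P) x y := by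
  induction hz with
  | refl => exact ⟨x, rfl, .refl⟩
  | @tail c d _ hcd ih =>
    obtain ⟨y, hy, hxy⟩ := ih
    obtain ⟨i, hcd⟩ := hcd
    obtain ⟨d, hd⟩ := d
    obtain ⟨w, rfl⟩ := QuotientGroup.mk_surjective d
    have hPw := mk_mem_fixedPoints_iff.1 hd
    obtain ⟨b, hb, hbS⟩ := hS.2.2 _ (le_conj_smul_iff_conj_inv_smul_le.1 hPw) (hP.conj_smul _)
    refine ⟨w * b⁻¹, ?_, hxy.tail ⟨?_, K i, ⟨i, rfl⟩, ?_⟩⟩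
    · rw [QuotientGroup.eq]
      simpa using hb
    · rw [le_conj_smul_iff_conj_inv_smul_le, mul_inv_rev, inv_inv, conj_mul_smul]
      exact hbS
    · have hadj : Subgroup.quotientMapOfLE (hBK i) c.1 =
          Subgroup.quotientMapOfLE (hBK i) (w : G ⧸ B) := hcd
      rw [← hy] at hadj
      have h1 : y⁻¹ * w ∈ K i := QuotientGroup.eq.1 hadj
      rw [← mul_assoc]
      exact (K i).mul_mem h1 ((K i).inv_mem (hBK i hb))

theorem reflTransGen_galleryStep {I : Type*} [Nonempty I] {B S P : Subgroup G}
    {K : I → Subgroup G} (hBK : ∀ i, B ≤ K i) (hS : IsSylowOf p S B) (hP : IsFinPSubgroup p P)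
    (hconn : ((ChamberSystem.coset B K hBK).fixed P).Connected) {x y : G}
    (hx : P ≤ conj x • S) (hy : P ≤ conj y • S) :
    Relation.ReflTransGen (GalleryStep S (Set.range K) P) x y := by
  obtain ⟨i⟩ := ‹Nonempty I›
  have hfx := mk_mem_fixedPoints_iff.2 (hx.trans (conj_smul_mono x hS.1))
  have hfy := mk_mem_fixedPoints_iff.2 (hy.trans (conj_smul_mono y hS.1))
  obtain ⟨w, hw, hxw⟩ := exists_galleryStep_of_reflTransGen hBK hS hP
    (hconn.2 ⟨_, hfx⟩ ⟨_, hfy⟩)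
  exact hxw.tail ⟨hy, K i, ⟨i, rfl⟩, hBK i (QuotientGroup.eq.1 hw)⟩

theorem eq_top_of_connected_of_isEmpty {I : Type*} [IsEmpty I] {B P : Subgroup G}
    {K : I → Subgroup G} (hBK : ∀ i, B ≤ K i) (hP : P = ⊥)
    (hconn : ((ChamberSystem.coset B K hBK).fixed P).Connected) : B = ⊤ := by
  subst hP
  refine (Subgroup.eq_top_iff' B).2 fun g => ?_
  have hfix : ∀ a : G, (a : G ⧸ B) ∈ MulAction.fixedPoints (⊥ : Subgroup G) (G ⧸ B) := fun a =>
    mk_mem_fixedPoints_iff.2 bot_le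
  have h := hconn.2 ⟨_, hfix 1⟩ ⟨_, hfix g⟩
  rcases Relation.ReflTransGen.cases_head h with h | ⟨_, ⟨i, -⟩, -⟩
  · have h1 : ((1 : G) : G ⧸ B) = (g : G ⧸ B) := congrArg Subtype.val h
    simpa using QuotientGroup.eq.1 h1
  · exact isEmptyElim i

end Completions

theorem theorem4p8 (p : ℕ) [Fact p.Prime] {I : Type*} [Finite I] (A : GroupDiagram I)
    {G : Type*} [Group G] (Φ : A.Completion G) (hΦ : Φ.Faithful)
    (hconn : ∀ P : Subgroup G, Finite P → IsPGroup p P → (Φ.chambers.fixed P).Connected)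
    (S : Subgroup G) (hSB : S ≤ Φ.subB)
    (hS : ∃ T : Sylow p Φ.subB, (T : Subgroup Φ.subB) = S.subgroupOf Φ.subB)
    (F : FusionSystem S) (hF : F = fusionOf S ⊤ le_top)
    (ha : ∀ P : Subgroup S, F.Centric P → F.FullyNormalized P →
      MulAction.IsPretransitive (AutBy (P.map S.subtype))
        (FixedOrbits (P.map S.subtype) (G ⧸ Φ.subB)))
    (hb : ∀ P : Subgroup S, F.Centric P →
      ∀ R : Subgroup (AutBy (P.map S.subtype)), IsPGroup p R →
        ((Φ.chambersFixedOrbits (P.map S.subtype)).fixed R).Connected)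
    (hc : ∀ (i : I) (P : Subgroup S),
      (fusionOf S (Φ.subG i) (hSB.trans (Φ.subB_le_subG i))).Essential p P → F.Centric P) :
    IsSylowIn p S ∧ F.Saturated p := by
  subst hF
  have hfinB : Finite Φ.subB := Set.finite_range Φ.φ
  have hfinG : ∀ i, Finite (Φ.subG i) := fun i => Set.finite_range (Φ.φi i)
  obtain ⟨T, hT⟩ := hS
  have hSylB : IsSylowOf p S Φ.subB := by
    have := isSylowOf_of_sylow T
    rwa [hT, Subgroup.map_subgroupOf_eq_of_le hSB] at this
  have hSp : IsFinPSubgroup p S := hSylB.2.1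
  have hSylG : ∀ V : Subgroup G, IsFinPSubgroup p V → ∃ g : G, conj g • V ≤ S := by
    intro V hV
    obtain ⟨⟨x, hx⟩⟩ := (hconn V hV.1 hV.2).1
    obtain ⟨x, rfl⟩ := QuotientGroup.mk_surjective x
    obtain ⟨b, -, hbS⟩ := hSylB.2.2 _
      (le_conj_smul_iff_conj_inv_smul_le.1 (mk_mem_fixedPoints_iff.1 hx)) (hV.conj_smul _)
    exact ⟨b * x⁻¹, by rwa [conj_mul_smul]⟩
  have hcentric : ∀ P : Subgroup G, IsFinPSubgroup p P → IsPCentric p P →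
      HasCentralizerSylow p P := by
    intro P hP hPc
    obtain ⟨g, hg⟩ := hSylG P hP
    have hmap := Subgroup.map_subgroupOf_eq_of_le hg
    have hgood : HasCentralizerSylow p (conj g • P) := by
      refine hasCentralizerSylow_of_connected Φ.subB_le_subG hfinG
        (fun V hV => (hSylG V hV).imp fun _ h => h.trans hSB) (hP.conj_smul g)
        (hPc.conj_smul g) ?_
      have h1 := hb ((conj g • P).subgroupOf S)
        ((isPCentric_iff_centric hSp hSylG).1 (by rw [hmap]; exact hPc.conj_smul g))
      rw [hmap] at h1
      exact h1
    have := hgood.conj_smul g⁻¹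
    rwa [conj_inv_smul_smul] at this
  have hgood : ∀ P : Subgroup G, IsFinPSubgroup p P → HasCentralizerSylow p P := by
    rcases isEmpty_or_nonempty I with hI | hI
    · have htop := eq_top_of_connected_of_isEmpty Φ.subB_le_subG rfl
        (hconn ⊥ inferInstance IsPGroup.of_bot)
      refine hasCentralizerSylow_of_isPCentric (𝒦 := {⊤}) hSp hSylG ?_ ?_ ?_ hcentric
      · rintro K rfl
        exact ⟨htop ▸ hfinB, le_top⟩
      · rintro K rfl _ Q hQ
        exact (isPCentric_iff_centric hSp hSylG).2 hQ.1
      · intro P _ x y _ hy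
        exact .single ⟨hy, ⊤, rfl, trivial⟩
    · refine hasCentralizerSylow_of_isPCentric (𝒦 := Set.range Φ.subG) hSp hSylG ?_ ?_ ?_ hcentric
      · rintro _ ⟨i, rfl⟩
        exact ⟨hfinG i, hSB.trans (Φ.subB_le_subG i)⟩
      · rintro _ ⟨i, rfl⟩ _ Q hQ
        exact (isPCentric_iff_centric hSp hSylG).2 (hc i Q hQ)
      · intro P hP x y hx hy
        exact reflTransGen_galleryStep Φ.subB_le_subG hSylB hP (hconn P hP.1 hP.2) hx hy
  exact ⟨⟨hSp.1, hSp.2, fun Q hQ hQp => hSylG Q ⟨hQ, hQp⟩⟩,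
    saturated_of_hasCentralizerSylow hSp hSylG hgood⟩
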